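/- **Setting.** Fix $N\ge 1$, let $\mathbb S=\{1,\dots,N\}$, $\bar{\mathbb S}=\{\bar 1,\dots,\bar N\}$, $\mathcal S=\mathbb S\cup\bar{\mathbb S}$. Coefficients are formal power series over $\mathbb C$ in the times $t_{ja}$ ($j\ge 1$, $a\in\mathcal S$), and infinite sums are understood coefficientwise in the times. The charges $s=(s_a)_{a\in\mathcal S}\in\mathbb Z^{\mathcal S}$ satisfy $\sum_a s_a=0$; for $a\ne b$ put $(T_{(a,b)}f)(s_a,s_b)=f(s_a+1,s_b-1)$. Let $\mathfrak g$ be an associative algebra of Laurent series $X=\sum_{j\in\mathbb Z}X_j(n)\Lambda^j$ with $N\times N$ matrix coefficients $X_j(n)$, $n\in\mathbb Z$, with the product $(X(n)\Lambda^i)(Y(n)\Lambda^j)=X(n)Y(n+i)\Lambda^{i+j}$ (all products in $\mathfrak g$ converge, lie in $\mathfrak g$ and are associative), containing $1$, $\Lambda^{\pm1}$, the operator $n$ and the matrix units $E_{kl}$. Write $G$ for its group of units, $X_+=\sum_{j\ge0}X_j\Lambda^j$ and $X_-=\sum_{j<0}X_j\Lambda^j$; $G_-$ (resp. $G_+$)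 is the set of units which together with their inverses are of the form $1+\sum_{j<0}X_j\Lambda^j$ (resp. $\sum_{j\ge0}X_j\Lambda^j$). Assume that $$W_0=\sum_k E_{kk}\Lambda^{s_k}\exp\Big(\sum_{j\ge1}t_{jk}\Lambda^j\Big),\qquad \bar W_0=\sum_k E_{kk}\Lambda^{-s_{\bar k}}\exp\Big(\sum_{j\ge1}t_{j\bar k}\Lambda^{-j}\Big)$$ lie in $G$, and that $g\in G$ (independent of $s$), $S=1+\varphi_1(n)\Lambda^{-1}+\cdots\in G_-$ and $\bar S=\bar\varphi_0(n)+\bar\varphi_1(n)\Lambda+\cdots\in G_+$ satisfy $S\,W_0\,g=\bar S\,\bar W_0$ for all charges $s$. Put $W=SW_0$, $\bar W=\bar S\bar W_0$, and $L=W\Lambda W^{-1}$, $M=WnW^{-1}$, $C_{kk}=WE_{kk}W^{-1}$, $\bar L=\bar W\Lambda\bar W^{-1}$, $\bar M=\bar Wn\bar W^{-1}$, $\bar C_{kk}=\bar WE_{kk}\bar W^{-1}$. **Scalar operators.** Fix $a_0\in\mathcal S\setminus\{1\}$ and $b_0\in\mathcal S\setminus\{\bar1\}$. Let $\mathcal T_1=T_{(1,a_0)}$,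 $\mathcal T_a=T_{(a,1)}$ for $a\ne1$, and $\bar{\mathcal T}_{\bar1}=T_{(\bar1,b_0)}$, $\bar{\mathcal T}_a=T_{(a,\bar1)}$ for $a\neq\bar1$. For $T=\mathcal T_a$ consider the algebra of series $\sum_j c_jT^j$ with coefficients $c_j(n,s)$, where, in each order in the times, the powers of $T$ are bounded above uniformly in $(n,s)$. Put $$\mathcal K_a=\begin{cases}1+\varphi_{1,11}T^{-1}+\varphi_{2,11}T^{-2}+\cdots,&a=1,\\ \varphi_{1,1k}+\varphi_{2,1k}T^{-1}+\cdots,&a=k\neq1,\\ \bar\varphi_{0,1k}+\bar\varphi_{1,1k}T^{-1}+\cdots,&a=\bar k.\end{cases}$$ If $\mathcal K_a$ is invertible in this algebra, put $\mathcal W_a=\mathcal K_a\circ\exp(\sum_{j\ge1}t_{ja}T^j)$, $$\mathcal L_a=\mathcal K_a\circ T\circ\mathcal K_a^{-1},\qquad \mathcal M_a=n-\nu_a+\operatorname{sg}(a)\,\mathcal W_a\circ s_a\circ\mathcal W_a^{-1},$$ where $\operatorname{sg}(a)=1$ for $a\in\mathbb S$, $\operatorname{sg}(a)=-1$ for $a\in\bar{\mathbb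 S}$, $\nu_a=1$ for $a\in\mathbb S\setminus\{1\}$ and $\nu_a=0$ otherwise. Define $\bar{\mathcal K}_a,\bar{\mathcal L}_a,\bar{\mathcal M}_a$ by the same formulas with $T=\bar{\mathcal T}_a$. The projections are as follows. For $c=\sum_jc_j\mathcal T_a^j$: $c_+=\sum_{j\ge0}c_j\mathcal T_1^j$ if $a=1$, and $c_+=\sum_{j>0}c_j\mathcal T_a^j$ if $a\ne1$. For $c=\sum_jc_j\bar{\mathcal T}_a^j$: $c_+=\sum_{j\ge0}c_j\bar{\mathcal T}_1^j$ if $a=1$; $c_+=\sum_{j>0}c_j\bar{\mathcal T}_{\bar1}^j$ if $a=\bar1$ and $b_0=1$; and $c_+=\sum_{j>0}c_j(\bar{\mathcal T}_a^j-1)$ in all other cases. **Statement.** Let $F(x,y)=\sum_{i\ge0,\,j\in\mathbb Z}F_{ij}x^iy^j$ with $F_{ij}\in\mathbb C$, where the powers of $y$ are bounded above and, for every $j$, $\sum_iF_{ij}x^i$ converges for all $x\in\mathbb C$ (for example $F$ a polynomial in $x,y,y^{-1}$). For every $k\in\{1,\dots,N\}$: (i) if $\mathcal K_k$ and $\bar{\mathcal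 K}_k$ are invertible, then all the series involved converge and $$F(\mathcal M_k,\mathcal L_k)_+(E_{11}W)=F(\bar{\mathcal M}_k,\bar{\mathcal L}_k)_+(E_{11}W)=E_{11}\big(F(M,L)C_{kk}\big)_+W,$$ $$F(\mathcal M_k,\mathcal L_k)_+(E_{11}\bar W)=F(\bar{\mathcal M}_k,\bar{\mathcal L}_k)_+(E_{11}\bar W)=E_{11}\big(F(M,L)C_{kk}\big)_+\bar W;$$ (ii) if $\mathcal K_{\bar k}$ and $\bar{\mathcal K}_{\bar k}$ are invertible, then all the series involved converge and $$F(\mathcal M_{\bar k},\mathcal L_{\bar k})_+(E_{11}W)=F(\bar{\mathcal M}_{\bar k},\bar{\mathcal L}_{\bar k})_+(E_{11}W)=E_{11}\big(F(\bar M,\bar L^{-1})\bar C_{kk}\big)_-W,$$ $$F(\mathcal M_{\bar k},\mathcal L_{\bar k})_+(E_{11}\bar W)=F(\bar{\mathcal M}_{\bar k},\bar{\mathcal L}_{\bar k})_+(E_{11}\bar W)=E_{11}\big(F(\bar M,\bar L^{-1})\bar C_{kk}\big)_-\bar W.$$ -/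

import Mathlib

open scoped MvPowerSeries.WithPiTopology

noncomputable section

namespace Toda

/-! ### Indices, times, charges -/

/-- The index set `𝒮 = 𝕊 ∪ 𝕊̄`: `Sum.inl k` is the index `k ∈ 𝕊` and `Sum.inr k` is the barred index
`k̄ ∈ 𝕊̄`. The distinguished indices `1` and `1̄` are `Sum.inl 0` and `Sum.inr 0`. -/
abbrev Idx (N : ℕ) := Fin N ⊕ Fin N

/-- Formal power series over `ℂ` in the times `t_{ja}`, `j = 1, 2, …`, `a ∈ 𝒮`. It carries the
topology of coefficientwise convergence, and all infinite sums below refer to it. -/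
abbrev Coef (N : ℕ) := MvPowerSeries (ℕ+ × Idx N) ℂ

/-- The zero charge sector: `s = (s_a)` in `ℤ^𝒮` with `∑ s_a = 0`. -/
def chargeLattice (N : ℕ) : AddSubgroup (Idx N → ℤ) where
  carrier := {s | ∑ a, s a = 0}
  zero_mem' := by simp
  add_mem' := by
    intro s s' hs hs'
    change ∑ a, s a = 0 at hs
    change ∑ a, s' a = 0 at hs'
    change ∑ a, (s + s') a = 0
    simp only [Pi.add_apply, Finset.sum_add_distrib, hs, hs', add_zero]
  neg_mem' := by
    intro s hs
    change ∑ a, s a = 0 at hs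
    change ∑ a, (-s) a = 0
    simp only [Pi.neg_apply, Finset.sum_neg_distrib, hs, neg_zero]

abbrev Charge (N : ℕ) := chargeLattice N

/-- The displacement of charges under `T_{(a,b)}`, namely `s_a ↦ s_a + 1`, `s_b ↦ s_b - 1`. The shift
operator itself is `(T_{(a,b)} f)(s) = f (s + transfer a b)`. -/
def transfer {N : ℕ} (a b : Idx N) : Charge N :=
  ⟨Pi.single a 1 - Pi.single b 1, by
    show ∑ c, (Pi.single a (1 : ℤ) - Pi.single b (1 : ℤ) : Idx N → ℤ) c = 0
    simp only [Pi.sub_apply, Finset.sum_sub_distrib, Finset.sum_pi_single', Finset.mem_univ,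
      if_true, sub_self]⟩

/-! ### Laurent series in the shift `Λ` -/

/-- A formal series `∑_{j ∈ ℤ} X_j(n) Λ^j` with `N × N` matrix coefficients; `X j n` is `X_j(n)`. -/
abbrev ShiftSeries (N : ℕ) := ℤ → ℤ → Matrix (Fin N) (Fin N) (Coef N)

/-- `∑_j X_j(n) Λ^j` with a single term `X(n) Λ^j`. -/
def monomialShift {N : ℕ} (j : ℤ) (X : ℤ → Matrix (Fin N) (Fin N) (Coef N)) : ShiftSeries N :=
  fun i n => if i = j then X n else 0

/-- The product `(X_i(n) Λ^i) · (Y_j(n) Λ^j) = X_i(n) Y_j(n+i) Λ^{i+j}`, extended to series. -/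
def convolve {N : ℕ} (X Y : ShiftSeries N) : ShiftSeries N :=
  fun j n => ∑' i : ℤ, X i n * Y (j - i) (n + i)

/-- The product `X · Y` converges coefficientwise and equals `Z`. -/
def IsProduct {N : ℕ} (X Y Z : ShiftSeries N) : Prop :=
  ∀ j n, HasSum (fun i : ℤ => X i n * Y (j - i) (n + i)) (Z j n)

/-- The projection `X ↦ X_+` onto `𝔤_+`. -/
def posPart {N : ℕ} (X : ShiftSeries N) : ShiftSeries N := fun j n => if 0 ≤ j then X j n else 0

/-- The projection `X ↦ X_-` onto `𝔤_-`. -/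
def negPart {N : ℕ} (X : ShiftSeries N) : ShiftSeries N := fun j n => if j < 0 then X j n else 0

/-- `E_{11} X`. -/
def firstRow {N : ℕ} [NeZero N] (X : ShiftSeries N) : ShiftSeries N :=
  fun j n => Matrix.single 0 0 1 * X j n

/-- An associative algebra of (two-sided) Laurent series in `Λ`: a linear space of series whose
products converge, stay in the space and are associative, and which contains `1`, `Λ`, `Λ⁻¹`, the
multiplication by `n` and the matrix units. -/
structure LaurentAlgebra (N : ℕ) where
  carrier : Submodule ℂ (ShiftSeries N)
  summable_mul : ∀ X ∈ carrier, ∀ Y ∈ carrier, ∀ j n,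
    Summable (fun i : ℤ => X i n * Y (j - i) (n + i))
  mul_mem : ∀ X ∈ carrier, ∀ Y ∈ carrier, convolve X Y ∈ carrier
  mul_assoc : ∀ X ∈ carrier, ∀ Y ∈ carrier, ∀ Z ∈ carrier,
    convolve (convolve X Y) Z = convolve X (convolve Y Z)
  one_mem : monomialShift 0 (fun _ => 1) ∈ carrier
  shift_mem : monomialShift 1 (fun _ => 1) ∈ carrier
  shift_inv_mem : monomialShift (-1) (fun _ => 1) ∈ carrier
  position_mem : monomialShift 0 (fun n => (n : Matrix (Fin N) (Fin N) (Coef N))) ∈ carrier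
  matrixUnit_mem : ∀ k l : Fin N, monomialShift 0 (fun _ => Matrix.single k l 1) ∈ carrier

instance {N : ℕ} : CoeSort (LaurentAlgebra N) Type := ⟨fun 𝔤 => 𝔤.carrier⟩

lemma monomialShift_convolve {N : ℕ} (i : ℤ) (A : ℤ → Matrix (Fin N) (Fin N) (Coef N))
    (X : ShiftSeries N) :
    convolve (monomialShift i A) X = fun j n => A n * X (j - i) (n + i) := by
  funext j n
  show ∑' k : ℤ, _ = _
  rw [tsum_eq_single i]
  · simp [monomialShift]
  · intro k hk
    simp [monomialShift, hk]

lemma convolve_one {N : ℕ} (X : ShiftSeries N) :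
    convolve X (monomialShift 0 (fun _ => 1)) = X := by
  funext j n
  show ∑' k : ℤ, _ = _
  rw [tsum_eq_single j]
  · simp [monomialShift]
  · intro k hk
    have : j - k ≠ 0 := fun h => hk (by omega)
    simp [monomialShift, this]

instance {N : ℕ} (𝔤 : LaurentAlgebra N) : Ring 𝔤 :=
  { (inferInstance : AddCommGroup 𝔤.carrier) with
    mul := fun X Y => ⟨convolve X.1 Y.1, 𝔤.mul_mem _ X.2 _ Y.2⟩
    one := ⟨_, 𝔤.one_mem⟩
    left_distrib := by
      rintro ⟨X, hX⟩ ⟨Y, hY⟩ ⟨Z, hZ⟩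
      apply Subtype.ext
      funext j n
      show ∑' i : ℤ, X i n * (Y (j - i) (n + i) + Z (j - i) (n + i)) = _
      simp only [mul_add]
      exact (𝔤.summable_mul X hX Y hY j n).tsum_add (𝔤.summable_mul X hX Z hZ j n)
    right_distrib := by
      rintro ⟨X, hX⟩ ⟨Y, hY⟩ ⟨Z, hZ⟩
      apply Subtype.ext
      funext j n
      show ∑' i : ℤ, (X i n + Y i n) * Z (j - i) (n + i) = _
      simp only [add_mul]
      exact (𝔤.summable_mul X hX Z hZ j n).tsum_add (𝔤.summable_mul Y hY Z hZ j n)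
    zero_mul := by
      rintro ⟨X, hX⟩
      apply Subtype.ext
      funext j n
      show ∑' i : ℤ, (0 : Matrix (Fin N) (Fin N) (Coef N)) * X (j - i) (n + i) = 0
      simp
    mul_zero := by
      rintro ⟨X, hX⟩
      apply Subtype.ext
      funext j n
      show ∑' i : ℤ, X i n * (0 : Matrix (Fin N) (Fin N) (Coef N)) = 0
      simp
    mul_assoc := by
      rintro ⟨X, hX⟩ ⟨Y, hY⟩ ⟨Z, hZ⟩
      exact Subtype.ext (𝔤.mul_assoc X hX Y hY Z hZ)
    one_mul := by
      rintro ⟨X, hX⟩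
      apply Subtype.ext
      show convolve (monomialShift 0 fun _ => 1) X = X
      rw [monomialShift_convolve]
      simp
    mul_one := by
      rintro ⟨X, hX⟩
      exact Subtype.ext (convolve_one X) }

namespace LaurentAlgebra

variable {N : ℕ} (𝔤 : LaurentAlgebra N)

/-- `Λ`, an element of the group of units `G` of `𝔤`. -/
def shift : 𝔤ˣ where
  val := ⟨_, 𝔤.shift_mem⟩
  inv := ⟨_, 𝔤.shift_inv_mem⟩
  val_inv := by
    apply Subtype.ext
    show convolve _ _ = monomialShift 0 _
    rw [monomialShift_convolve]
    funext j n
    have : (j - 1 = -1) ↔ j = 0 := by omega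
    simp [monomialShift, this]
  inv_val := by
    apply Subtype.ext
    show convolve _ _ = monomialShift 0 _
    rw [monomialShift_convolve]
    funext j n
    simp [monomialShift]

/-- Multiplication by `n`. -/
def position : 𝔤 := ⟨_, 𝔤.position_mem⟩

/-- The constant matrix unit `E_{kl}`. -/
def matrixUnit (k l : Fin N) : 𝔤 := ⟨_, 𝔤.matrixUnit_mem k l⟩

/-- `X ∈ G_-`: both `X` and `X⁻¹` have the form `1 + ∑_{j<0} X_j(n) Λ^j`. -/
def IsGMinus (X : 𝔤ˣ) : Prop :=
  ∀ Y ∈ ({X, X⁻¹} : Set 𝔤ˣ), ∀ n : ℤ, (Y : 𝔤).1 0 n = 1 ∧ ∀ j > 0, (Y : 𝔤).1 j n = 0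

/-- `X ∈ G_+`: both `X` and `X⁻¹` have the form `∑_{j≥0} X_j(n) Λ^j`. -/
def IsGPlus (X : 𝔤ˣ) : Prop :=
  ∀ Y ∈ ({X, X⁻¹} : Set 𝔤ˣ), ∀ n : ℤ, ∀ j < 0, (Y : 𝔤).1 j n = 0

end LaurentAlgebra

/-! ### The exponentials of the times -/

/-- `∑_{j ≥ 1} t_{ja} y^j`, a power series in `y`. -/
def timeSeries {N : ℕ} (a : Idx N) : PowerSeries (Coef N) :=
  PowerSeries.mk fun j => if h : 0 < j then MvPowerSeries.X (⟨j, h⟩, a) else 0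

/-- `exp (∑_{j ≥ 1} t_{ja} y^j)`, a power series in `y`. -/
def expTimes {N : ℕ} (a : Idx N) : PowerSeries (Coef N) :=
  (PowerSeries.exp ℂ).subst (timeSeries a)

/-- `exp (- ∑_{j ≥ 1} t_{ja} y^j)`. -/
def expTimesInv {N : ℕ} (a : Idx N) : PowerSeries (Coef N) :=
  (PowerSeries.evalNegHom (PowerSeries.exp ℂ)).subst (timeSeries a)

/-- The coefficient of `y^m`, for an integer `m`. -/
def intCoeff {N : ℕ} (p : PowerSeries (Coef N)) (m : ℤ) : Coef N :=
  if 0 ≤ m then PowerSeries.coeff m.toNat p else 0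

/-- `W_0 = ∑_k E_{kk} Λ^{s_k} exp (∑_{j≥1} t_{jk} Λ^j)`. -/
def W0Series {N : ℕ} (s : Charge N) : ShiftSeries N :=
  fun j _ => Matrix.diagonal fun k => intCoeff (expTimes (Sum.inl k)) (j - s.1 (Sum.inl k))

/-- `W̄_0 = ∑_k E_{kk} Λ^{-s_k̄} exp (∑_{j≥1} t_{jk̄} Λ^{-j})`. -/
def W0barSeries {N : ℕ} (s : Charge N) : ShiftSeries N :=
  fun j _ => Matrix.diagonal fun k => intCoeff (expTimes (Sum.inr k)) (-j - s.1 (Sum.inr k))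

/-! ### Solutions of the factorization problem and the matrix Lax and Orlov–Schulman operators -/

/-- A solution `S(s,t)`, `S̄(s,t)` of the factorization problem `S · W_0 · g = S̄ · W̄_0` on the whole
zero charge sector, with `g ∈ G`, `S ∈ G_-`, `S̄ ∈ G_+`. -/
structure Solution {N : ℕ} (𝔤 : LaurentAlgebra N) where
  g : 𝔤ˣ
  W0 : Charge N → 𝔤ˣ
  W0bar : Charge N → 𝔤ˣ
  S : Charge N → 𝔤ˣ
  Sbar : Charge N → 𝔤ˣ
  W0_eq : ∀ s, (W0 s : 𝔤).1 = W0Series s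
  W0bar_eq : ∀ s, (W0bar s : 𝔤).1 = W0barSeries s
  S_mem : ∀ s, 𝔤.IsGMinus (S s)
  Sbar_mem : ∀ s, 𝔤.IsGPlus (Sbar s)
  factorization : ∀ s, S s * W0 s * g = Sbar s * W0bar s

namespace Solution

variable {N : ℕ} {𝔤 : LaurentAlgebra N} (sol : Solution 𝔤) (s : Charge N)

/-- The dressing operators `W = S · W_0` and `W̄ = S̄ · W̄_0`. -/
def W : 𝔤ˣ := sol.S s * sol.W0 s
def Wbar : 𝔤ˣ := sol.Sbar s * sol.W0bar s

/-- The Lax operators `L = W Λ W⁻¹` and `L̄ = W̄ Λ W̄⁻¹`. -/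
def L : 𝔤ˣ := sol.W s * 𝔤.shift * (sol.W s)⁻¹
def Lbar : 𝔤ˣ := sol.Wbar s * 𝔤.shift * (sol.Wbar s)⁻¹

/-- `C_{kk} = W E_{kk} W⁻¹` and `C̄_{kk} = W̄ E_{kk} W̄⁻¹`. -/
def C (k : Fin N) : 𝔤 := (sol.W s : 𝔤) * 𝔤.matrixUnit k k * ((sol.W s)⁻¹ : 𝔤ˣ)
def Cbar (k : Fin N) : 𝔤 := (sol.Wbar s : 𝔤) * 𝔤.matrixUnit k k * ((sol.Wbar s)⁻¹ : 𝔤ˣ)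

/-- The Orlov–Schulman operators `M = W n W⁻¹` and `M̄ = W̄ n W̄⁻¹`. -/
def M : 𝔤 := (sol.W s : 𝔤) * 𝔤.position * ((sol.W s)⁻¹ : 𝔤ˣ)
def Mbar : 𝔤 := (sol.Wbar s : 𝔤) * 𝔤.position * ((sol.Wbar s)⁻¹ : 𝔤ˣ)

end Solution

/-! ### Symbols -/

/-- A symbol `F(x,y) = ∑_{i ≥ 0, j ∈ ℤ} F_{ij} x^i y^j` with complex coefficients, of bounded degree in
`y`, whose coefficient of each `y^j` converges everywhere. -/
structure Symbol where
  coeff : ℕ → ℤ → ℂ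
  bounded : ∃ J : ℤ, ∀ i, ∀ j > J, coeff i j = 0
  entire : ∀ (j : ℤ) (x : ℂ), Summable fun i : ℕ => coeff i j * x ^ i

/-- The terms `F_{ij} M^i L^j C` of `F(M,L) C`. -/
def symbolTerm {N : ℕ} {𝔤 : LaurentAlgebra N} (F : Symbol) (M : 𝔤) (L : 𝔤ˣ) (C : 𝔤)
    (p : ℕ × ℤ) : ShiftSeries N :=
  F.coeff p.1 p.2 • (M ^ p.1 * ((L ^ p.2 : 𝔤ˣ) : 𝔤) * C).1

/-- `F(M,L) C = ∑ F_{ij} M^i L^j C`. -/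
def symbolSeries {N : ℕ} {𝔤 : LaurentAlgebra N} (F : Symbol) (M : 𝔤) (L : 𝔤ˣ) (C : 𝔤) :
    ShiftSeries N :=
  ∑' p : ℕ × ℤ, symbolTerm F M L C p

/-! ### Laurent series in the charge shifts -/

/-- The formal operators `∑_{j ∈ ℤ} c_j T^j`, where `(T f)(s) = f (s + τ)` and the coefficients are
functions `c_j(n,s)` with values in the formal power series in the times; in every order in the
times the series is bounded in the direction of positive powers of `T`. `coeff j n s` is
`c_j(n,s)`. -/
@[ext] structure ShiftOp {N : ℕ} (τ : Charge N) where
  coeff : ℤ → ℤ → Charge N → Coef N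
  bounded : ∀ d, ∃ B : ℤ, ∀ j > B, ∀ n s, MvPowerSeries.coeff d (coeff j n s) = 0

namespace ShiftOp

variable {N : ℕ} {τ : Charge N}

lemma bounded' (P : ShiftOp τ) (d : ℕ+ × Idx N →₀ ℕ) :
    ∃ B : ℤ, ∀ e ≤ d, ∀ j > B, ∀ n s, MvPowerSeries.coeff e (P.coeff j n s) = 0 := by
  classical
  choose b hb using P.bounded
  obtain ⟨B, hB⟩ := ((Set.finite_Iic d).image b).bddAbove
  exact ⟨B, fun e he j hj => hb e j (lt_of_le_of_lt (hB ⟨e, he, rfl⟩) hj)⟩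

lemma coeff_mul_eq_zero {d : ℕ+ × Idx N →₀ ℕ} {p q : Coef N}
    (h : (∀ e ≤ d, MvPowerSeries.coeff e p = 0) ∨ (∀ e ≤ d, MvPowerSeries.coeff e q = 0)) :
    MvPowerSeries.coeff d (p * q) = 0 := by
  classical
  rw [MvPowerSeries.coeff_mul]
  refine Finset.sum_eq_zero fun x hx => ?_
  have hx := Finset.HasAntidiagonal.mem_antidiagonal.1 hx
  rcases h with h | h
  · rw [h x.1 (hx ▸ le_self_add), zero_mul]
  · rw [h x.2 (hx ▸ le_add_self), mul_zero]

lemma summable_of_finite {ι : Type*} {f : ι → Coef N}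
    (h : ∀ d, {i | MvPowerSeries.coeff d (f i) ≠ 0}.Finite) : Summable f := by
  rw [MvPowerSeries.WithPiTopology.summable_iff_summable_coeff]
  exact fun d => summable_of_hasFiniteSupport (h d)

lemma coeff_tsum_eq_zero {ι : Type*} {f : ι → Coef N} {d : ℕ+ × Idx N →₀ ℕ}
    (h : ∀ i, MvPowerSeries.coeff d (f i) = 0) :
    MvPowerSeries.coeff d (∑' i, f i) = 0 := by
  by_cases hf : Summable f
  · have := (MvPowerSeries.WithPiTopology.hasSum_iff_hasSum_coeff.1 hf.hasSum) d
    simp only [h] at this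
    exact this.unique hasSum_zero
  · rw [tsum_eq_zero_of_not_summable hf, map_zero]

lemma summable_mul (P Q : ShiftOp τ) (j n : ℤ) (s : Charge N) :
    Summable fun i : ℤ => P.coeff i n s * Q.coeff (j - i) n (s + i • τ) := by
  refine summable_of_finite fun d => ?_
  obtain ⟨B, hB⟩ := P.bounded' d
  obtain ⟨B', hB'⟩ := Q.bounded' d
  refine (Set.finite_Icc (j - B') B).subset fun i hi => ?_
  by_contra hcon
  apply hi
  apply coeff_mul_eq_zero
  rw [Set.mem_Icc, not_and_or, not_le, not_le] at hcon
  rcases hcon with hcon | hcon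
  · exact Or.inr fun e he => hB' e he _ (by omega) _ _
  · exact Or.inl fun e he => hB e he _ hcon _ _

/-- The composition `(c_i T^i) ∘ (e_j T^j) = c_i(n,s) e_j(n, s + iτ) T^{i+j}`, extended to series. -/
def comp (P Q : ShiftOp τ) : ShiftOp τ where
  coeff j n s := ∑' i : ℤ, P.coeff i n s * Q.coeff (j - i) n (s + i • τ)
  bounded d := by
    obtain ⟨B, hB⟩ := P.bounded' d
    obtain ⟨B', hB'⟩ := Q.bounded' d
    refine ⟨B + B', fun j hj n s => coeff_tsum_eq_zero fun i => coeff_mul_eq_zero ?_⟩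
    by_cases hi : B < i
    · exact Or.inl fun e he => hB e he _ hi _ _
    · exact Or.inr fun e he => hB' e he _ (by omega) _ _

/-- The operator `c(n,s) T^i`. -/
def term (τ : Charge N) (i : ℤ) (c : ℤ → Charge N → Coef N) : ShiftOp τ where
  coeff j n s := if j = i then c n s else 0
  bounded _ := ⟨i, fun j hj n s => by rw [if_neg (by omega), map_zero]⟩

instance : Zero (ShiftOp τ) := ⟨⟨0, fun _ => ⟨0, fun _ _ _ _ => by simp⟩⟩⟩
instance : One (ShiftOp τ) := ⟨term τ 0 1⟩
instance : Mul (ShiftOp τ) := ⟨comp⟩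
instance : Add (ShiftOp τ) := ⟨fun P Q => ⟨fun j n s => P.coeff j n s + Q.coeff j n s, fun d => by
  obtain ⟨B, hB⟩ := P.bounded d
  obtain ⟨B', hB'⟩ := Q.bounded d
  refine ⟨max B B', fun j hj n s => ?_⟩
  rw [map_add, hB j (lt_of_le_of_lt (le_max_left _ _) hj),
    hB' j (lt_of_le_of_lt (le_max_right _ _) hj), add_zero]⟩⟩
instance : Neg (ShiftOp τ) := ⟨fun P => ⟨fun j n s => - P.coeff j n s, fun d => by
  obtain ⟨B, hB⟩ := P.bounded d
  exact ⟨B, fun j hj n s => by rw [map_neg, hB j hj, neg_zero]⟩⟩⟩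

lemma zero_coeff (j n : ℤ) (s : Charge N) : (0 : ShiftOp τ).coeff j n s = 0 := rfl
lemma one_coeff (j n : ℤ) (s : Charge N) :
    (1 : ShiftOp τ).coeff j n s = if j = 0 then 1 else 0 := rfl
lemma add_coeff (P Q : ShiftOp τ) (j n : ℤ) (s : Charge N) :
    (P + Q).coeff j n s = P.coeff j n s + Q.coeff j n s := rfl
lemma neg_coeff (P : ShiftOp τ) (j n : ℤ) (s : Charge N) :
    (-P).coeff j n s = - P.coeff j n s := rfl
lemma mul_coeff (P Q : ShiftOp τ) (j n : ℤ) (s : Charge N) :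
    (P * Q).coeff j n s = ∑' i : ℤ, P.coeff i n s * Q.coeff (j - i) n (s + i • τ) := rfl

lemma mul_assoc' (P Q R : ShiftOp τ) : P * Q * R = P * (Q * R) := by
  ext1
  funext j n s
  let f : ℤ × ℤ → Coef N := fun x =>
    P.coeff x.1 n s * Q.coeff x.2 n (s + x.1 • τ) * R.coeff (j - x.1 - x.2) n (s + (x.1 + x.2) • τ)
  have hf : Summable f := by
    refine summable_of_finite fun d => ?_
    obtain ⟨B, hB⟩ := P.bounded' d
    obtain ⟨B', hB'⟩ := Q.bounded' d
    obtain ⟨B'', hB''⟩ := R.bounded' d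
    refine ((Set.finite_Icc (j - B' - B'') B).prod (Set.finite_Icc (j - B - B'') B')).subset
      fun x hx => ?_
    have h1 : x.1 ≤ B := by
      by_contra hcon
      refine hx (coeff_mul_eq_zero (Or.inl fun e he => coeff_mul_eq_zero (Or.inl fun e' he' =>
        hB e' (he'.trans he) _ (by omega) _ _)))
    have h2 : x.2 ≤ B' := by
      by_contra hcon
      refine hx (coeff_mul_eq_zero (Or.inl fun e he => coeff_mul_eq_zero (Or.inr fun e' he' =>
        hB' e' (he'.trans he) _ (by omega) _ _)))
    have h3 : j - x.1 - x.2 ≤ B'' := by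
      by_contra hcon
      exact hx (coeff_mul_eq_zero (Or.inr fun e he => hB'' e he _ (by omega) _ _))
    simp only [Set.mem_prod, Set.mem_Icc]
    omega
  have hL : (P * (Q * R)).coeff j n s = ∑' x, f x := by
    rw [mul_coeff, hf.tsum_prod]
    refine tsum_congr fun k => ?_
    rw [mul_coeff, ← (summable_mul Q R (j - k) n (s + k • τ)).tsum_mul_left]
    refine tsum_congr fun l => ?_
    show _ = P.coeff k n s * Q.coeff l n (s + k • τ) * _
    rw [add_assoc, ← add_smul, mul_assoc]
  have hsh : Function.Injective fun x : ℤ × ℤ => (x.2, x.1 - x.2) := by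
    rintro ⟨a, b⟩ ⟨c, d⟩ h
    simp only [Prod.mk.injEq] at h ⊢
    omega
  let σ : ℤ × ℤ ≃ ℤ × ℤ :=
    { toFun := fun x => (x.2, x.1 - x.2)
      invFun := fun x => (x.1 + x.2, x.1)
      left_inv := fun x => by ext <;> simp
      right_inv := fun x => by ext <;> simp }
  have hf' : Summable (f ∘ σ) := σ.summable_iff.2 hf
  have hR : (P * Q * R).coeff j n s = ∑' x, f x := by
    rw [← σ.tsum_eq f, mul_coeff]
    change _ = ∑' x, (f ∘ σ) x
    rw [hf'.tsum_prod]
    refine tsum_congr fun k => ?_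
    rw [mul_coeff, ← (summable_mul P Q k n s).tsum_mul_right]
    refine tsum_congr fun l => ?_
    show _ = P.coeff l n s * Q.coeff (k - l) n (s + l • τ) *
      R.coeff (j - l - (k - l)) n (s + (l + (k - l)) • τ)
    have e1 : j - l - (k - l) = j - k := by omega
    have e2 : l + (k - l) = k := by omega
    rw [e1, e2]
  rw [hL, hR]

instance : Ring (ShiftOp τ) where
  add_assoc P Q R := by ext1; funext j n s; simp only [add_coeff, add_assoc]
  zero_add P := by ext1; funext j n s; simp only [add_coeff, zero_coeff, zero_add]
  add_zero P := by ext1; funext j n s; simp only [add_coeff, zero_coeff, add_zero]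
  add_comm P Q := by ext1; funext j n s; simp only [add_coeff, add_comm]
  neg_add_cancel P := by
    ext1; funext j n s; simp only [add_coeff, neg_coeff, zero_coeff, neg_add_cancel]
  nsmul := nsmulRec
  zsmul := zsmulRec
  left_distrib P Q R := by
    ext1; funext j n s
    simp only [add_coeff, mul_coeff, mul_add]
    exact (summable_mul P Q j n s).tsum_add (summable_mul P R j n s)
  right_distrib P Q R := by
    ext1; funext j n s
    simp only [add_coeff, mul_coeff, add_mul]
    exact (summable_mul P R j n s).tsum_add (summable_mul Q R j n s)
  zero_mul P := by ext1; funext j n s; simp only [mul_coeff, zero_coeff, zero_mul, tsum_zero]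
  mul_zero P := by ext1; funext j n s; simp only [mul_coeff, zero_coeff, mul_zero, tsum_zero]
  mul_assoc := mul_assoc'
  one_mul P := by
    ext1; funext j n s
    rw [mul_coeff, tsum_eq_single 0 (fun i hi => by rw [one_coeff, if_neg hi, zero_mul])]
    simp [one_coeff]
  mul_one P := by
    ext1; funext j n s
    rw [mul_coeff, tsum_eq_single j (fun i hi => by
      rw [one_coeff, if_neg (by omega), mul_zero])]
    simp [one_coeff]

/-- The shift `T` itself. -/
def T (τ : Charge N) : (ShiftOp τ)ˣ where
  val := term τ 1 1
  inv := term τ (-1) 1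
  val_inv := by
    ext1; funext j n s
    rw [mul_coeff, tsum_eq_single 1 (fun i hi => by simp [term, hi])]
    have : (j - 1 = -1) ↔ j = 0 := by omega
    simp [term, one_coeff, this]
  inv_val := by
    ext1; funext j n s
    rw [mul_coeff, tsum_eq_single (-1) (fun i hi => by simp [term, hi])]
    simp [term, one_coeff]

/-- The operator `∑_{m ≥ 0} p_m T^m` with coefficients `p_m` independent of `n` and `s`. -/
def ofPowerSeries (τ : Charge N) (p : PowerSeries (Coef N))
    (hp : ∀ d, ∃ B : ℤ, ∀ j > B, MvPowerSeries.coeff d (intCoeff p j) = 0) : ShiftOp τ where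
  coeff j _ _ := intCoeff p j
  bounded d := by
    obtain ⟨B, hB⟩ := hp d
    exact ⟨B, fun j hj _ _ => hB j hj⟩

lemma ofPowerSeries_mul (p q : PowerSeries (Coef N)) (hp hq) (hpq : p * q = 1) :
    ofPowerSeries τ p hp * ofPowerSeries τ q hq = 1 := by
  classical
  ext1; funext j n s
  rw [mul_coeff, one_coeff]
  show ∑' i : ℤ, intCoeff p i * intCoeff q (j - i) = _
  by_cases hj : 0 ≤ j
  · obtain ⟨m, rfl⟩ := Int.eq_ofNat_of_zero_le hj
    have h1 : PowerSeries.coeff m (p * q) = if m = 0 then 1 else 0 := by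
      rw [hpq, PowerSeries.coeff_one]
    rw [PowerSeries.coeff_mul, Finset.Nat.sum_antidiagonal_eq_sum_range_succ_mk] at h1
    have h2 : ((m : ℤ) = 0) ↔ m = 0 := by omega
    simp only [h2]
    rw [← h1]
    rw [tsum_eq_sum (s := (Finset.range (m + 1)).map Nat.castEmbedding)]
    · rw [Finset.sum_map]
      refine Finset.sum_congr rfl fun i hi => ?_
      rw [Finset.mem_range] at hi
      have e1 : (0 : ℤ) ≤ (Nat.castEmbedding i : ℤ) := by simp
      have e2 : (0 : ℤ) ≤ (m : ℤ) - (Nat.castEmbedding i : ℤ) := by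
        simp only [Nat.castEmbedding_apply]; omega
      have e3 : ((m : ℤ) - (Nat.castEmbedding i : ℤ)).toNat = m - i := by
        simp only [Nat.castEmbedding_apply]; omega
      rw [intCoeff, intCoeff, if_pos e1, if_pos e2, e3]
      simp
    · intro i hi
      by_cases h0 : 0 ≤ i
      · have : ¬ (0 ≤ (m : ℤ) - i) := fun hcon => hi (by
          rw [Finset.mem_map]
          exact ⟨i.toNat, by rw [Finset.mem_range]; omega, by simp [h0]⟩)
        rw [intCoeff, intCoeff, if_neg this, mul_zero]
      · rw [intCoeff, if_neg h0, zero_mul]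
  · have hne : j ≠ 0 := by omega
    rw [if_neg hne]
    refine (tsum_congr fun i => ?_).trans tsum_zero
    by_cases h0 : 0 ≤ i
    · have : ¬ (0 ≤ j - i) := by omega
      rw [intCoeff, intCoeff, if_neg this, mul_zero]
    · rw [intCoeff, if_neg h0, zero_mul]

/-- The coefficient of `y^m` involves only monomials in the times of weight `m`, where `t_{ja}` has
weight `j`. -/
def IsWeighted (p : PowerSeries (Coef N)) : Prop :=
  ∀ m d, MvPowerSeries.coeff d (PowerSeries.coeff m p) ≠ 0 →
    Finsupp.weight (fun x : ℕ+ × Idx N => (x.1 : ℕ)) d = m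

lemma isWeighted_one : IsWeighted (1 : PowerSeries (Coef N)) := by
  classical
  intro m d h
  rw [PowerSeries.coeff_one] at h
  split_ifs at h with hm
  · rw [MvPowerSeries.coeff_one] at h
    split_ifs at h with hd
    · simp [hm, hd]
    · simp at h
  · simp at h

lemma isWeighted_mul {p q : PowerSeries (Coef N)} (hp : IsWeighted p) (hq : IsWeighted q) :
    IsWeighted (p * q) := by
  classical
  intro m d h
  rw [PowerSeries.coeff_mul, map_sum] at h
  obtain ⟨x, hx, h⟩ := Finset.exists_ne_zero_of_sum_ne_zero h
  rw [MvPowerSeries.coeff_mul] at h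
  obtain ⟨y, hy, h⟩ := Finset.exists_ne_zero_of_sum_ne_zero h
  rw [← Finset.HasAntidiagonal.mem_antidiagonal.1 hx,
    ← Finset.HasAntidiagonal.mem_antidiagonal.1 hy, map_add,
    hp _ _ (left_ne_zero_of_mul h), hq _ _ (right_ne_zero_of_mul h)]

lemma isWeighted_timeSeries (a : Idx N) : IsWeighted (timeSeries a) := by
  classical
  intro m d h
  rw [timeSeries, PowerSeries.coeff_mk] at h
  split_ifs at h with hm
  · rw [MvPowerSeries.coeff_X] at h
    split_ifs at h with hd
    · simp [hd, Finsupp.weight_single]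
    · simp at h
  · simp at h

lemma hasSubst_timeSeries (a : Idx N) : PowerSeries.HasSubst (timeSeries a) :=
  PowerSeries.HasSubst.of_constantCoeff_zero' (by
    rw [← PowerSeries.coeff_zero_eq_constantCoeff_apply, timeSeries, PowerSeries.coeff_mk]
    simp)

lemma bounded_subst (a : Idx N) (f : PowerSeries ℂ) (d : ℕ+ × Idx N →₀ ℕ) :
    ∃ B : ℤ, ∀ j > B, MvPowerSeries.coeff d (intCoeff (f.subst (timeSeries a)) j) = 0 := by
  refine ⟨(Finsupp.weight (fun x : ℕ+ × Idx N => (x.1 : ℕ)) d : ℕ), fun j hj => ?_⟩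
  have hpow : ∀ k : ℕ, IsWeighted (timeSeries a ^ k) := by
    intro k
    induction k with
    | zero => rw [pow_zero]; exact isWeighted_one
    | succ k ih => rw [pow_succ]; exact isWeighted_mul ih (isWeighted_timeSeries a)
  rw [intCoeff, if_pos (by omega), PowerSeries.coeff_subst' (hasSubst_timeSeries a),
    finsum_eq_sum _ (PowerSeries.coeff_subst_finite' (hasSubst_timeSeries a) f _), map_sum]
  refine Finset.sum_eq_zero fun k _ => ?_
  have : MvPowerSeries.coeff d (PowerSeries.coeff j.toNat (timeSeries a ^ k)) = 0 := by
    by_contra h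
    have := hpow k _ _ h
    omega
  show MvPowerSeries.coeff d (PowerSeries.coeff k f • _) = 0
  rw [map_smul, this, smul_zero]

lemma expTimes_mul_inv (a : Idx N) : expTimes a * expTimesInv a = 1 := by
  rw [expTimes, expTimesInv, ← PowerSeries.subst_mul (hasSubst_timeSeries a),
    PowerSeries.exp_mul_exp_neg_eq_one, ← PowerSeries.coe_substAlgHom (hasSubst_timeSeries a),
    map_one]

/-- `𝒲_{0,a} = exp (∑_{j ≥ 1} t_{ja} T^j)`. -/
def expT (τ : Charge N) (a : Idx N) : (ShiftOp τ)ˣ where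
  val := ofPowerSeries τ (expTimes a) (bounded_subst a _)
  inv := ofPowerSeries τ (expTimesInv a) (bounded_subst a _)
  val_inv := ofPowerSeries_mul _ _ _ _ (expTimes_mul_inv a)
  inv_val := ofPowerSeries_mul _ _ _ _ (by rw [mul_comm]; exact expTimes_mul_inv a)

end ShiftOp

/-! ### The scalar Lax and Orlov–Schulman operators -/

/-- The displacement of the unbarred shift `𝒯_a`: `T_{(1,a₀)}` if `a = 1`, and `T_{(a,1)}` otherwise. -/
def unbarredShift {N : ℕ} [NeZero N] (a₀ a : Idx N) : Charge N :=
  if a = Sum.inl 0 then transfer (Sum.inl 0) a₀ else transfer a (Sum.inl 0)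

/-- The displacement of the barred shift `𝒯̄_a`: `T_{(1̄,b₀)}` if `a = 1̄`, and `T_{(a,1̄)}` otherwise. -/
def barredShift {N : ℕ} [NeZero N] (b₀ a : Idx N) : Charge N :=
  if a = Sum.inr 0 then transfer (Sum.inr 0) b₀ else transfer a (Sum.inr 0)

/-- `sg(a)`. -/
def sg {N : ℕ} : Idx N → ℤ
  | Sum.inl _ => 1
  | Sum.inr _ => -1

/-- `ν_a`. -/
def nu {N : ℕ} [NeZero N] : Idx N → ℤ
  | Sum.inl k => if k = 0 then 0 else 1
  | Sum.inr _ => 0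

namespace Solution

variable {N : ℕ} [NeZero N] {𝔤 : LaurentAlgebra N} (sol : Solution 𝔤)

/-- The scalar dressing operator along the displacement `τ`. With `S = 1 + φ_1 Λ⁻¹ + ⋯` and
`S̄ = φ̄_0 + φ̄_1 Λ + ⋯` it is `1 + φ_{1,11} T⁻¹ + φ_{2,11} T⁻² + ⋯` for `a = 1`,
`φ_{1,1k} + φ_{2,1k} T⁻¹ + ⋯` for `a = k ≠ 1`, and `φ̄_{0,1k} + φ̄_{1,1k} T⁻¹ + ⋯` for `a = k̄`. -/
def K (τ : Charge N) (a : Idx N) : ShiftOp τ where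
  coeff j n s :=
    if 0 < j then 0 else
      match a with
      | Sum.inl k =>
        if k = 0 then (sol.S s : 𝔤).1 j n 0 0 else (sol.S s : 𝔤).1 (j - 1) n 0 k
      | Sum.inr k => (sol.Sbar s : 𝔤).1 (-j) n 0 k
  bounded _ := ⟨0, fun j hj n s => by rw [if_pos (by omega), map_zero]⟩

variable {sol} {τ : Charge N} {a : Idx N} (hK : IsUnit (sol.K τ a))

/-- The scalar wave operator `𝒲_a = 𝒦_a ∘ 𝒲_{0,a}`. -/
def scalarW : (ShiftOp τ)ˣ := hK.unit * ShiftOp.expT τ a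

/-- The scalar Lax operator `ℒ_a = 𝒦_a ∘ T ∘ 𝒦_a⁻¹`. -/
def scalarL : (ShiftOp τ)ˣ := hK.unit * ShiftOp.T τ * hK.unit⁻¹

/-- The scalar Orlov–Schulman operator `ℳ_a = n - ν_a + sg(a) 𝒲_a ∘ s_a ∘ 𝒲_a⁻¹`. -/
def scalarM : ShiftOp τ :=
  ShiftOp.term τ 0 (fun n _ => ((n - nu a : ℤ) : Coef N)) +
    sg a • ((scalarW hK : ShiftOp τ) * ShiftOp.term τ 0 (fun _ s => ((s.1 a : ℤ) : Coef N)) *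
      ((scalarW hK)⁻¹ : (ShiftOp τ)ˣ))

/-- The terms `F_{ij} ℳ_a^i ℒ_a^j` of `F(ℳ_a, ℒ_a)`, as families of coefficients `c_j(n,s)`. -/
def scalarTerm (F : Symbol) (p : ℕ × ℤ) : ℤ → ℤ → Charge N → Coef N :=
  F.coeff p.1 p.2 • (scalarM hK ^ p.1 * ((scalarL hK ^ p.2 : (ShiftOp τ)ˣ) : ShiftOp τ)).coeff

/-- `F(ℳ_a, ℒ_a) = ∑ F_{ij} ℳ_a^i ℒ_a^j`. -/
def scalarSeries (F : Symbol) : ℤ → ℤ → Charge N → Coef N := ∑' p : ℕ × ℤ, scalarTerm hK F p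

end Solution

/-! ### The projections `( )_+` of scalar operators and their action -/

/-- `c_+(X) = Y` for `c = ∑ c_j 𝒯_a^j`, the projection being that of the unbarred algebra:
`c_+ = ∑_{j ≥ 0} c_j 𝒯_1^j` if `a = 1`, and `c_+ = ∑_{j > 0} c_j 𝒯_a^j` otherwise. -/
def UnbarredPlusActs {N : ℕ} [NeZero N] (a₀ a : Idx N) (c : ℤ → ℤ → Charge N → Coef N)
    (X Y : Charge N → ShiftSeries N) : Prop :=
  ∀ s j n, HasSum (fun i : ℤ =>
    if a = Sum.inl 0 then
      if 0 ≤ i then c i n s • X (s + i • unbarredShift a₀ a) j n else 0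
    else
      if 0 < i then c i n s • X (s + i • unbarredShift a₀ a) j n else 0) (Y s j n)

/-- `c_+(X) = Y` for `c = ∑ c_j 𝒯̄_a^j`, the projection being that of the barred algebra:
`c_+ = ∑_{j ≥ 0} c_j 𝒯̄_1^j` if `a = 1`, `c_+ = ∑_{j > 0} c_j 𝒯̄_1̄^j` if `a = 1̄` and `b₀ = 1`, and
`c_+ = ∑_{j > 0} c_j (𝒯̄_a^j - 1)` otherwise. -/
def BarredPlusActs {N : ℕ} [NeZero N] (b₀ a : Idx N) (c : ℤ → ℤ → Charge N → Coef N)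
    (X Y : Charge N → ShiftSeries N) : Prop :=
  ∀ s j n, HasSum (fun i : ℤ =>
    if a = Sum.inl 0 then
      if 0 ≤ i then c i n s • X (s + i • barredShift b₀ a) j n else 0
    else if a = Sum.inr 0 ∧ b₀ = Sum.inl 0 then
      if 0 < i then c i n s • X (s + i • barredShift b₀ a) j n else 0
    else
      if 0 < i then c i n s • (X (s + i • barredShift b₀ a) j n - X s j n) else 0) (Y s j n)

end Toda

end

noncomputable section

namespace Toda

/-! Since `g` is independent of the charges, `W̄ = W g` gives `U(s',s) = W(s') W(s)⁻¹ = W̄(s')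
W̄(s)⁻¹`. A shift of charges thus acts on `W` and on `W̄` as left multiplication by the same element
`U(s + iτ, s)` of `𝔤`, and the theorem reduces to an identity between first rows of series standing
in front of `W` or `W̄`.

Let `c_i` be the coefficients of `F(ℳ_a, ℒ_a)`, let `a = k`, and let `τ` raise `s_a` by one. Without
projections, `E₁₁ F(M,L) C_kk = ∑_{i ∈ ℤ} c_i E₁₁ W(s+iτ) E_kk W(s)⁻¹`, and similarly for barred `a`
(`tsum_dressedSymbol_mul_kernel`). Up to a shift of degree, the coefficients of `𝒲_a` are the
`(1,k)` entries of `W` (`scalarW_coeff`), and `F(ℳ_a, ℒ_a) 𝒲_a = 𝒲_a F(n - ν_a + sg(a) s_a, T)`; the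
two sides of the identity are the two ways of bracketing one double sum.

The projections come from a degree count. The exponentials cancel in `W(s') E_ll W(s)⁻¹ = S(s')
Λ^{s'_l - s_l} E_ll S(s)⁻¹`, so its first row has no nonnegative powers unless `s_l` is raised, or
`l = 1` and `s_1` is unchanged, when they amount to `E₁₁`. The barred analogue has no negative
powers unless the charge `l̄` is raised. As `U` is the sum over `l` of either family, for each `i`
kept by the projection the first row of `U`, or of `U - 1` when the projection contains `T^i - 1`,
is the required half of the kernel of the raised index; for all other `i` that half vanishes
(`unbarredKernel_inl`, `barredKernel_inl`, `unbarredKernel_inr`, `barredKernel_inr`).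

In each order in the times the dressing operators and their inverses are bounded in the direction
`Λ^{sg(a)}`, so the rearranged sums are finite there, except for the numerical series `∑_i F_ij x^i`
at integers `x` (`hasSum_symbol`). -/

variable {N : ℕ}

/-! ### Entries of products in `𝔤` -/

section Algebra

variable {𝔤 : LaurentAlgebra N}

lemma hasSum_mul (X Y : 𝔤) (j n : ℤ) :
    HasSum (fun i : ℤ => X.1 i n * Y.1 (j - i) (n + i)) ((X * Y).1 j n) :=
  (𝔤.summable_mul _ X.2 _ Y.2 j n).hasSum

lemma hasSum_mul_apply (X Y : 𝔤) (j n : ℤ) (r c : Fin N) :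
    HasSum (fun i : ℤ => ∑ l, X.1 i n r l * Y.1 (j - i) (n + i) l c) ((X * Y).1 j n r c) := by
  have h := Pi.hasSum.1 (Pi.hasSum.1 (hasSum_mul X Y j n) r) c
  simpa only [Matrix.mul_apply] using h

lemma sum_val {ι : Type*} (t : Finset ι) (X : ι → 𝔤) (j n : ℤ) :
    (∑ l ∈ t, X l).1 j n = ∑ l ∈ t, (X l).1 j n := by
  rw [AddSubmonoidClass.coe_finsetSum, Finset.sum_apply, Finset.sum_apply]

lemma one_val (j n : ℤ) : (1 : 𝔤).1 j n = if j = 0 then 1 else 0 := rfl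

lemma convolve_monomialShift (X : ShiftSeries N) (i : ℤ) (A : ℤ → Matrix (Fin N) (Fin N) (Coef N)) :
    convolve X (monomialShift i A) = fun j n => X (j - i) n * A (n + (j - i)) := by
  funext j n
  show ∑' k : ℤ, _ = _
  rw [tsum_eq_single (j - i)]
  · simp [monomialShift]
  · intro k hk
    have : j - k ≠ i := fun h => hk (by omega)
    simp [monomialShift, this]

lemma monomial_mul_val {X : 𝔤} {i : ℤ} {A : ℤ → Matrix (Fin N) (Fin N) (Coef N)}
    (hX : X.1 = monomialShift i A) (Y : 𝔤) (j n : ℤ) :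
    (X * Y).1 j n = A n * Y.1 (j - i) (n + i) := by
  show convolve X.1 Y.1 j n = _
  rw [hX, monomialShift_convolve]

lemma mul_monomial_val {Y : 𝔤} {i : ℤ} {A : ℤ → Matrix (Fin N) (Fin N) (Coef N)}
    (hY : Y.1 = monomialShift i A) (X : 𝔤) (j n : ℤ) :
    (X * Y).1 j n = X.1 (j - i) n * A (n + (j - i)) := by
  show convolve X.1 Y.1 j n = _
  rw [hY, convolve_monomialShift]

lemma monomial_mul_monomial {X Y : 𝔤} {i j : ℤ} {A B : ℤ → Matrix (Fin N) (Fin N) (Coef N)}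
    (hX : X.1 = monomialShift i A) (hY : Y.1 = monomialShift j B) :
    (X * Y).1 = monomialShift (i + j) fun n => A n * B (n + i) := by
  funext k n
  rw [monomial_mul_val hX, hY]
  have : k - i = j ↔ k = i + j := by omega
  simp only [monomialShift, this]
  split_ifs <;> simp

lemma shift_zpow_val (j : ℤ) :
    ((𝔤.shift ^ j : 𝔤ˣ) : 𝔤).1 = monomialShift j fun _ => 1 := by
  induction j with
  | zero => rfl
  | succ j ih =>
    rw [zpow_add_one, Units.val_mul,
      monomial_mul_monomial ih (show (𝔤.shift : 𝔤).1 = monomialShift 1 fun _ => 1 from rfl)]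
    simp
  | pred j ih =>
    rw [zpow_sub_one, Units.val_mul, monomial_mul_monomial ih
      (show ((𝔤.shift⁻¹ : 𝔤ˣ) : 𝔤).1 = monomialShift (-1) fun _ => 1 from rfl)]
    simp [sub_eq_add_neg]

lemma position_pow_val (i : ℕ) :
    (𝔤.position ^ i).1 =
      monomialShift 0 fun n : ℤ => (n : Matrix (Fin N) (Fin N) (Coef N)) ^ i := by
  induction i with
  | zero => simp only [pow_zero]; rfl
  | succ i ih =>
    rw [pow_succ, monomial_mul_monomial ih
      (show 𝔤.position.1 = monomialShift 0 fun n : ℤ => (n : Matrix (Fin N) (Fin N) (Coef N)) from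
        rfl)]
    simp [pow_succ]

/-- The trivial factor `1 •` puts the monomial into the form required by `hasSum_mul_single_mul`. -/
lemma shift_zpow_mul_matrixUnit_val (m : ℤ) (l : Fin N) :
    (((𝔤.shift ^ m : 𝔤ˣ) : 𝔤) * 𝔤.matrixUnit l l).1 =
      monomialShift m fun _ => (1 : Coef N) • Matrix.single l l 1 := by
  rw [monomial_mul_monomial (shift_zpow_val m)
    (show (𝔤.matrixUnit l l).1 = monomialShift 0 fun _ => Matrix.single l l 1 from rfl)]
  simp

lemma position_pow_mul_shift_zpow_mul_matrixUnit_val (i : ℕ) (m : ℤ) (l : Fin N) :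
    (𝔤.position ^ i * ((𝔤.shift ^ m : 𝔤ˣ) : 𝔤) * 𝔤.matrixUnit l l).1 =
      monomialShift m fun n => ((n : Coef N) ^ i) • Matrix.single l l 1 := by
  rw [_root_.mul_assoc, monomial_mul_monomial (position_pow_val i)
    (shift_zpow_mul_matrixUnit_val m l)]
  congr 1
  · simp
  · funext n
    rw [one_smul, show (n : Matrix (Fin N) (Fin N) (Coef N)) ^ i =
      Matrix.scalar (Fin N) ((n : Coef N) ^ i) by rw [map_pow, map_intCast]]
    rw [Matrix.scalar_apply, ← Matrix.smul_eq_diagonal_mul]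

lemma sum_matrixUnit : ∑ l, 𝔤.matrixUnit l l = 1 := by
  apply Subtype.ext
  funext j n
  rw [sum_val, one_val]
  show ∑ l, (if j = 0 then Matrix.single l l (1 : Coef N) else 0) = _
  split_ifs
  · exact Matrix.sum_single_one
  · simp

/-- Entries of `X · x(n) E_{ll} Λ^m · Y`. -/
lemma hasSum_mul_single_mul {Z : 𝔤} {m : ℤ} {x : ℤ → Coef N} {l : Fin N}
    (hZ : Z.1 = monomialShift m fun n => x n • Matrix.single l l 1) (X Y : 𝔤) (J n : ℤ)
    (r c : Fin N) :
    HasSum (fun p : ℤ => x (n + p) * (X.1 p n r l * Y.1 (J - p - m) (n + p + m) l c))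
      ((X * Z * Y).1 J n r c) := by
  rw [_root_.mul_assoc]
  convert hasSum_mul_apply X (Z * Y) J n r c using 2 with p
  rw [Finset.sum_eq_single l]
  · rw [monomial_mul_val hZ, Matrix.smul_mul, Matrix.smul_apply, Matrix.single_mul_apply_same,
      one_mul, smul_eq_mul]
    ring
  · intro l' _ hl
    rw [monomial_mul_val hZ, Matrix.smul_mul, Matrix.smul_apply,
      Matrix.single_mul_apply_of_ne _ _ _ _ _ hl, smul_zero, mul_zero]
  · simp

end Algebra

/-! ### Orders in the times -/

/-- The family `y` vanishes above some degree up to the order `d`, uniformly in the parameter. -/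
def BddOrder {ι : Type*} (y : ℤ → ι → Coef N) : Prop :=
  ∀ d, ∃ B : ℤ, ∀ j > B, ∀ i, MvPowerSeries.coeff d (y j i) = 0

/-- Only finitely many orders lie below `d`, and these are the ones that enter the coefficient of
order `d` of a product. -/
lemma BddOrder.le {ι : Type*} {y : ℤ → ι → Coef N} (hy : BddOrder y) (d : ℕ+ × Idx N →₀ ℕ) :
    ∃ B : ℤ, ∀ e ≤ d, ∀ j > B, ∀ i, MvPowerSeries.coeff e (y j i) = 0 := by
  classical
  choose b hb using hy
  obtain ⟨B, hB⟩ := ((Set.finite_Iic d).image b).bddAbove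
  exact ⟨B, fun e he j hj => hb e j (lt_of_le_of_lt (hB ⟨e, he, rfl⟩) hj)⟩

/-- The map `p ↦ ε p + c` of `ℤ` for `ε = ±1`. -/
def affineEquiv (ε : ℤ) (hε : ε * ε = 1) (c : ℤ) : ℤ ≃ ℤ where
  toFun p := ε * p + c
  invFun u := ε * (u - c)
  left_inv p := by
    show ε * (ε * p + c - c) = p
    rw [add_sub_cancel_right, ← mul_assoc, hε, one_mul]
  right_inv u := by
    show ε * (ε * (u - c)) + c = u
    rw [← mul_assoc, hε, one_mul, sub_add_cancel]

lemma sg_mul_sg (a : Idx N) : sg a * sg a = 1 := by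
  rcases a with a | a <;> rfl

/-- The entries of `X` vanish above some power of `Λ^ε` in every order in the times. -/
def ShiftBdd (ε : ℤ) (X : ShiftSeries N) : Prop :=
  BddOrder fun j (x : ℤ × Fin N × Fin N) => X (ε * j) x.1 x.2.1 x.2.2

lemma ShiftBdd.of_forall {ε : ℤ} (hε : ε * ε = 1) {X : ShiftSeries N}
    (h : ∀ p n, 0 < ε * p → X p n = 0) : ShiftBdd ε X := fun d =>
  ⟨0, fun j hj x => by
    show MvPowerSeries.coeff d (X (ε * j) _ _ _) = 0
    rw [h _ _ (by rw [← mul_assoc, hε, one_mul]; exact hj), Matrix.zero_apply, map_zero]⟩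

/-- Degrees in `Λ^ε` add, so beyond `B + B'` one of the two factors is past its own bound. -/
lemma ShiftBdd.mul {𝔤 : LaurentAlgebra N} {ε : ℤ} (hε : ε * ε = 1) {X Y : 𝔤}
    (hX : ShiftBdd ε X.1) (hY : ShiftBdd ε Y.1) : ShiftBdd ε (X * Y).1 := by
  intro d
  obtain ⟨B, hB⟩ := hX.le d
  obtain ⟨B', hB'⟩ := hY.le d
  refine ⟨B + B', fun j hj x => ?_⟩
  have h := MvPowerSeries.WithPiTopology.hasSum_iff_hasSum_coeff.1
    (hasSum_mul_apply X Y (ε * j) x.1 x.2.1 x.2.2) d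
  refine h.unique ?_
  convert hasSum_zero using 2 with i
  rw [map_sum]
  refine Finset.sum_eq_zero fun l _ => ShiftOp.coeff_mul_eq_zero ?_
  by_cases hi : B < ε * i
  · left
    intro e he
    have := hB e he (ε * i) hi (x.1, x.2.1, l)
    simpa only [← mul_assoc, hε, one_mul] using this
  · right
    intro e he
    have := hB' e he (j - ε * i) (by omega) (x.1 + i, l, x.2.2)
    simpa only [mul_sub, ← mul_assoc, hε, one_mul] using this

/-- `∑_k E_{kk} Λ^{ε e_k} p_k(Λ^ε)`. -/
def diagSeries (ε : ℤ) (p : Fin N → PowerSeries (Coef N)) (e : Fin N → ℤ) : ShiftSeries N :=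
  fun j _ => Matrix.diagonal fun k => intCoeff (p k) (ε * j - e k)

/-- The coefficients of `p` vanish from some degree on, in every order in the times. -/
abbrev SeriesBdd (p : PowerSeries (Coef N)) : Prop :=
  ∀ d, ∃ B : ℤ, ∀ j > B, MvPowerSeries.coeff d (intCoeff p j) = 0

lemma W0Series_eq (s : Charge N) :
    W0Series s = diagSeries 1 (fun k => expTimes (Sum.inl k)) fun k => s.1 (Sum.inl k) := by
  funext j n
  simp only [W0Series, diagSeries, one_mul]

lemma W0barSeries_eq (s : Charge N) :
    W0barSeries s = diagSeries (-1) (fun k => expTimes (Sum.inr k)) fun k => s.1 (Sum.inr k) := by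
  funext j n
  simp only [W0barSeries, diagSeries, neg_one_mul]

lemma shiftBdd_diagSeries {ε : ℤ} (hε : ε * ε = 1) {p : Fin N → PowerSeries (Coef N)}
    (hp : ∀ k, SeriesBdd (p k)) (e : Fin N → ℤ) : ShiftBdd ε (diagSeries ε p e) := by
  intro d
  choose B hB using fun k => hp k d
  obtain ⟨C, hC⟩ := (Set.finite_range fun k => B k + e k).bddAbove
  refine ⟨C, fun j hj x => ?_⟩
  show MvPowerSeries.coeff d (Matrix.diagonal _ x.2.1 x.2.2) = 0
  rw [Matrix.diagonal_apply]
  split_ifs with h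
  · apply hB
    have := hC ⟨x.2.1, rfl⟩
    simp only [← mul_assoc, hε, one_mul] at this ⊢
    omega
  · exact map_zero _

/-- `D(e') E_{ll} = Λ^{ε (e'_l - e_l)} E_{ll} D(e)`. -/
lemma diagSeries_mul_matrixUnit {𝔤 : LaurentAlgebra N} {ε : ℤ} (hε : ε * ε = 1)
    {p : Fin N → PowerSeries (Coef N)} {e e' : Fin N → ℤ} {D D' : 𝔤}
    (hD : D.1 = diagSeries ε p e) (hD' : D'.1 = diagSeries ε p e') (l : Fin N) :
    D' * 𝔤.matrixUnit l l =
      ((𝔤.shift ^ (ε * (e' l - e l)) : 𝔤ˣ) : 𝔤) * 𝔤.matrixUnit l l * D := by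
  apply Subtype.ext
  funext j n
  rw [mul_monomial_val (show (𝔤.matrixUnit l l).1 = monomialShift 0 fun _ => Matrix.single l l 1
    from rfl), monomial_mul_val (shift_zpow_mul_matrixUnit_val _ l), hD, hD', one_smul]
  simp only [diagSeries]
  ext1 r c
  rw [Matrix.diagonal_mul, Matrix.mul_diagonal, Matrix.single_apply]
  split_ifs with h
  · rw [← h.1, ← h.2, mul_one, one_mul]
    congr 1
    linear_combination (e' l - e l) * hε
  · rw [mul_zero, zero_mul]

/-! ### Scalar operators paired with sequences. -/

lemma tsum_comp_eq {τ : Charge N} (P Q : ShiftOp τ) (n : ℤ) (s : Charge N) (y : ℤ → Coef N)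
    (hs : Summable fun x : ℤ × ℤ => P.coeff x.1 n s * Q.coeff x.2 n (s + x.1 • τ) * y (x.1 + x.2))
    : ∑' x : ℤ × ℤ, P.coeff x.1 n s * Q.coeff x.2 n (s + x.1 • τ) * y (x.1 + x.2) =
      ∑' m, (P * Q).coeff m n s * y m := by
  let σ : ℤ × ℤ ≃ ℤ × ℤ :=
    { toFun := fun x => (x.2, x.1 - x.2)
      invFun := fun x => (x.1 + x.2, x.1)
      left_inv := fun x => by ext <;> simp
      right_inv := fun x => by ext <;> simp }
  have hs' := σ.summable_iff.2 hs
  refine (σ.tsum_eq _).symm.trans (hs'.tsum_prod.trans ?_)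
  refine tsum_congr fun m => ?_
  rw [ShiftOp.mul_coeff, ← (ShiftOp.summable_mul P Q m n s).tsum_mul_right]
  refine tsum_congr fun i => ?_
  show P.coeff i n s * Q.coeff (m - i) n (s + i • τ) * y (i + (m - i)) = _
  rw [add_sub_cancel]

/-- Associativity of the pairing: the index `i + j` of `y` records the effect of `T^i T^j`, and
grouping by `m = i + j` produces the coefficients of `P * Q`. -/
lemma tsum_tsum_comp_eq {τ : Charge N} (P Q : ShiftOp τ) (n : ℤ) (s : Charge N) (y : ℤ → Coef N)
    (hs : Summable fun x : ℤ × ℤ => P.coeff x.1 n s * Q.coeff x.2 n (s + x.1 • τ) * y (x.1 + x.2))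
    (hi : ∀ i, Summable fun j => Q.coeff j n (s + i • τ) * y (i + j)) :
    ∑' i, P.coeff i n s * ∑' j, Q.coeff j n (s + i • τ) * y (i + j) =
      ∑' m, (P * Q).coeff m n s * y m := by
  rw [← tsum_comp_eq P Q n s y hs, hs.tsum_prod]
  refine tsum_congr fun i => ?_
  rw [← (hi i).tsum_mul_left]
  exact tsum_congr fun j => (mul_assoc _ _ _).symm

lemma SeriesBdd.finite_support {p : PowerSeries (Coef N)} (hp : SeriesBdd p)
    (d : ℕ+ × Idx N →₀ ℕ) :
    ∃ B : ℤ, ∀ e ≤ d, ∀ j ∉ Set.Icc 0 B, MvPowerSeries.coeff e (intCoeff p j) = 0 := by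
  obtain ⟨B, hB⟩ := BddOrder.le (y := fun j (_ : Unit) => intCoeff p j)
    (fun d => (hp d).imp fun B hB j hj _ => hB j hj) d
  refine ⟨B, fun e he j hj => ?_⟩
  by_cases h0 : 0 ≤ j
  · exact hB e he j (by simp only [Set.mem_Icc, not_and, not_le] at hj; exact hj h0) ()
  · rw [intCoeff, if_neg h0, map_zero]

/-- Multiplication of sequences by a power series can be undone by the inverse power series. -/
lemma tsum_intCoeff_inv {p q : PowerSeries (Coef N)} (hp : SeriesBdd p) (hq : SeriesBdd q)
    (hpq : q * p = 1) (z : ℤ → Coef N) :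
    ∑' v, intCoeff q v * ∑' u, intCoeff p u * z (v + u) = z 0 := by
  -- The coefficients do not depend on the charges, so any displacement would serve; zero is taken.
  -- In each order both series have finite support, hence `z` needs no decay.
  have h := tsum_tsum_comp_eq (τ := (0 : Charge N)) (ShiftOp.ofPowerSeries 0 q hq)
    (ShiftOp.ofPowerSeries 0 p hp) 0 0 z ?_ ?_
  · refine h.trans ?_
    rw [ShiftOp.ofPowerSeries_mul _ _ _ _ hpq, tsum_eq_single 0]
    · rw [ShiftOp.one_coeff, if_pos rfl, one_mul]
    · intro i hi
      rw [ShiftOp.one_coeff, if_neg hi, zero_mul]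
  · refine ShiftOp.summable_of_finite fun d => ?_
    obtain ⟨B, hB⟩ := hp.finite_support d
    obtain ⟨B', hB'⟩ := hq.finite_support d
    refine ((Set.finite_Icc 0 B').prod (Set.finite_Icc 0 B)).subset fun x hx => ?_
    by_contra hcon
    rw [Set.mem_prod, not_and_or] at hcon
    refine hx (ShiftOp.coeff_mul_eq_zero (Or.inl fun e he => ShiftOp.coeff_mul_eq_zero ?_))
    rcases hcon with hcon | hcon
    · exact Or.inl fun e' he' => hB' e' (he'.trans he) _ hcon
    · exact Or.inr fun e' he' => hB e' (he'.trans he) _ hcon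
  · intro i
    refine ShiftOp.summable_of_finite fun d => ?_
    obtain ⟨B, hB⟩ := hp.finite_support d
    refine (Set.finite_Icc 0 B).subset fun x hx => ?_
    by_contra hcon
    exact hx (ShiftOp.coeff_mul_eq_zero (Or.inl fun e he => hB e he _ hcon))

/-- The inverse in `𝔤` carries no a priori degree bound. Row `k` of `D D⁻¹ = 1` says that
multiplication by `p k` sends row `k` of `D⁻¹` to a known row; `tsum_intCoeff_inv` undoes this
multiplication on arbitrary two-sided sequences. -/
lemma inv_diagSeries {𝔤 : LaurentAlgebra N} {ε : ℤ} (hε : ε * ε = 1)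
    {p q : Fin N → PowerSeries (Coef N)} (hp : ∀ k, SeriesBdd (p k)) (hq : ∀ k, SeriesBdd (q k))
    (hpq : ∀ k, q k * p k = 1) {e : Fin N → ℤ} {D : 𝔤ˣ} (hD : (D : 𝔤).1 = diagSeries ε p e) :
    ((D⁻¹ : 𝔤ˣ) : 𝔤).1 = diagSeries ε q (-e) := by
  classical
  set Z : 𝔤 := ((D⁻¹ : 𝔤ˣ) : 𝔤) with hZ
  have h1 : ∀ J n k c, HasSum (fun u => intCoeff (p k) u *
      Z.1 (J - ε * (u + e k)) (n + ε * (u + e k)) k c)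
      (if J = 0 ∧ k = c then (1 : Coef N) else 0) := by
    intro J n k c
    have h := hasSum_mul_apply (D : 𝔤) Z J n k c
    rw [hZ, Units.mul_inv, ← (affineEquiv ε hε (-e k)).symm.hasSum_iff] at h
    convert h using 1
    · funext u
      show _ = ∑ l, (D : 𝔤).1 (ε * (u - -e k)) n k l * _
      rw [Finset.sum_eq_single k]
      · rw [hD]
        simp only [diagSeries, Matrix.diagonal_apply_eq]
        rw [← mul_assoc, hε, one_mul, sub_neg_eq_add, add_sub_cancel_right]
        simp only [affineEquiv, Equiv.coe_fn_symm_mk, sub_neg_eq_add]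
        rfl
      · intro l _ hl
        rw [hD]
        simp only [diagSeries]
        rw [Matrix.diagonal_apply_ne _ hl.symm, zero_mul]
      · simp
    · rw [one_val]
      by_cases hJ : J = 0 <;> simp [hJ, Matrix.one_apply]
  funext J n
  ext1 k c
  have h2 := tsum_intCoeff_inv (hp k) (hq k) (hpq k) fun w => Z.1 (J - ε * w) (n + ε * w) k c
  simp only [mul_zero, sub_zero, add_zero] at h2
  rw [← h2]
  -- The inner sum is `h1` with degree and position translated by opposite amounts.
  have h3 : ∀ v, ∑' u, intCoeff (p k) u * Z.1 (J - ε * (v + u)) (n + ε * (v + u)) k c =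
      if J + ε * (e k - v) = 0 ∧ k = c then (1 : Coef N) else 0 := by
    intro v
    rw [← (h1 (J + ε * (e k - v)) (n - ε * (e k - v)) k c).tsum_eq]
    refine tsum_congr fun u => ?_
    congr 2
    ring_nf
  simp only [h3, diagSeries, Pi.neg_apply, sub_neg_eq_add]
  -- The only `v` for which the degree `J + ε (e k - v)` is zero.
  rw [Matrix.diagonal_apply, tsum_eq_single (ε * J + e k)]
  · rw [show J + ε * (e k - (ε * J + e k)) = 0 by linear_combination (-J) * hε]
    split_ifs <;> simp_all
  · intro v hv
    rw [if_neg, mul_zero]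
    rintro ⟨h, -⟩
    exact hv (by linear_combination (-ε) * h + (e k - v) * hε)

/-! ### Sums over symbols -/

/-- The entire function `x ↦ ∑_i F_{ij} x^i`. -/
def Symbol.eval (F : Symbol) (j : ℤ) (x : ℂ) : ℂ := ∑' i : ℕ, F.coeff i j * x ^ i

lemma Symbol.exists_eval_eq_zero (F : Symbol) : ∃ J : ℤ, ∀ j > J, (∀ i, F.coeff i j = 0) ∧
    ∀ x, F.eval j x = 0 := by
  obtain ⟨J, hJ⟩ := F.bounded
  exact ⟨J, fun j hj => ⟨fun i => hJ i j hj, fun x => by simp [Symbol.eval, hJ _ j hj]⟩⟩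

lemma coeff_smul' (d : ℕ+ × Idx N →₀ ℕ) (z : ℂ) (p : Coef N) :
    MvPowerSeries.coeff d (z • p) = z * MvPowerSeries.coeff d p := by
  rw [map_smul, smul_eq_mul]

/-- Both the terms `M^i L^j C` and the terms `ℳ^i ℒ^j` have this shape, `x u` being an eigenvalue of
the conjugated multiplication operator. In a fixed order only finitely many pairs `(u, j)` with `j ≤
J` matter, so the claim is a finite sum of the numerical series `∑_i F_ij (x u)^i`. No control of
`G` is needed for `j > J`, where `F` vanishes. -/
lemma hasSum_symbol (F : Symbol) (x : ℤ → ℂ) (G : ℤ → ℤ → Coef N)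
    (hG : ∀ d, ∀ J : ℤ, {p : ℤ × ℤ | p.2 ≤ J ∧ MvPowerSeries.coeff d (G p.1 p.2) ≠ 0}.Finite) :
    HasSum (fun q : ℕ × ℤ => F.coeff q.1 q.2 • ∑' u, x u ^ q.1 • G u q.2)
      (∑' p : ℤ × ℤ, F.eval p.2 (x p.1) • G p.1 p.2) := by
  classical
  obtain ⟨J, hJ⟩ := F.exists_eval_eq_zero
  rw [MvPowerSeries.WithPiTopology.hasSum_iff_hasSum_coeff]
  intro d
  have hmem : ∀ p : ℤ × ℤ, p ∉ (hG d J).toFinset → p.2 ≤ J →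
      MvPowerSeries.coeff d (G p.1 p.2) = 0 := by
    intro p hp hpJ
    by_contra h
    exact hp ((hG d J).mem_toFinset.2 ⟨hpJ, h⟩)
  have hR : MvPowerSeries.coeff d (∑' p : ℤ × ℤ, F.eval p.2 (x p.1) • G p.1 p.2) =
      ∑ p ∈ (hG d J).toFinset, F.eval p.2 (x p.1) * MvPowerSeries.coeff d (G p.1 p.2) := by
    have hs : Summable fun p : ℤ × ℤ => F.eval p.2 (x p.1) • G p.1 p.2 := by
      refine ShiftOp.summable_of_finite fun d => (hG d J).subset fun p hp => ?_
      rw [Set.mem_ofPred_eq, coeff_smul'] at hp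
      exact ⟨not_lt.1 fun h => left_ne_zero_of_mul hp ((hJ _ h).2 _), right_ne_zero_of_mul hp⟩
    refine (MvPowerSeries.WithPiTopology.hasSum_iff_hasSum_coeff.1 hs.hasSum d).unique ?_
    simp only [coeff_smul']
    refine hasSum_sum_of_ne_finset_zero fun p hp => ?_
    by_cases h : p.2 ≤ J
    · rw [hmem p hp h, mul_zero]
    · rw [(hJ _ (not_le.1 h)).2, zero_mul]
  have hL : ∀ q : ℕ × ℤ, MvPowerSeries.coeff d (F.coeff q.1 q.2 • ∑' u, x u ^ q.1 • G u q.2) =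
      ∑ p ∈ (hG d J).toFinset, if p.2 = q.2 then
        F.coeff q.1 p.2 * x p.1 ^ q.1 * MvPowerSeries.coeff d (G p.1 p.2) else 0 := by
    intro q
    rw [coeff_smul']
    by_cases hq : q.2 ≤ J
    · have hs : Summable fun u => x u ^ q.1 • G u q.2 := by
        refine ShiftOp.summable_of_finite fun d => ((hG d J).image Prod.fst).subset fun u hu => ?_
        rw [Set.mem_ofPred_eq, coeff_smul'] at hu
        exact ⟨(u, q.2), ⟨hq, right_ne_zero_of_mul hu⟩, rfl⟩
      have h1 := (MvPowerSeries.WithPiTopology.hasSum_iff_hasSum_coeff.1 hs.hasSum d).mul_left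
        (F.coeff q.1 q.2)
      refine h1.unique ?_
      -- Each term is written as a sum of delta functions over the finite set, so that the sum over
      -- `u` can be taken pair by pair.
      have h2 : HasSum (fun u => ∑ p ∈ (hG d J).toFinset, if p = (u, q.2) then
          F.coeff q.1 p.2 * x p.1 ^ q.1 * MvPowerSeries.coeff d (G p.1 p.2) else 0)
          (∑ p ∈ (hG d J).toFinset, if p.2 = q.2 then
            F.coeff q.1 p.2 * x p.1 ^ q.1 * MvPowerSeries.coeff d (G p.1 p.2) else 0) := by
        refine hasSum_sum fun p _ => ?_
        have := hasSum_single (f := fun u => if p = (u, q.2) then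
          F.coeff q.1 p.2 * x p.1 ^ q.1 * MvPowerSeries.coeff d (G p.1 p.2) else 0) p.1
          (fun u hu => if_neg fun h => hu (by rw [h]))
        convert this using 1
        simp only [Prod.ext_iff, true_and]
      refine Eq.mp (congrArg (fun f => HasSum f _) (funext fun u => ?_)) h2
      rw [Finset.sum_ite_eq' (hG d J).toFinset (u, q.2) fun p =>
        F.coeff q.1 p.2 * x p.1 ^ q.1 * MvPowerSeries.coeff d (G p.1 p.2), coeff_smul']
      split_ifs with h
      · ring
      · rw [hmem (u, q.2) h hq, mul_zero, mul_zero]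
    · rw [(hJ _ (not_le.1 hq)).1, zero_mul]
      refine (Finset.sum_eq_zero fun p _ => ?_).symm
      split_ifs with h
      · rw [h, (hJ _ (not_le.1 hq)).1, zero_mul, zero_mul]
      · rfl
  rw [hR, funext hL]
  refine hasSum_sum fun p _ => ?_
  -- A fixed pair `p` meets only the terms of the symbol with `j = p.2`, which leaves the series for
  -- `F.eval p.2`.
  have hinj : Function.Injective fun i : ℕ => (i, p.2) := fun a b h => (Prod.ext_iff.1 h).1
  rw [← hinj.hasSum_iff]
  · have := (F.entire p.2 (x p.1)).hasSum.mul_right (MvPowerSeries.coeff d (G p.1 p.2))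
    refine Eq.mp (congrArg (fun f => HasSum f _) (funext fun i => ?_)) this
    simp
  · rintro ⟨i, j⟩ h
    exact if_neg fun h' => h ⟨i, Prod.ext rfl h'⟩

/-! ### Scalar operators -/

namespace ShiftOp

variable {τ : Charge N}

lemma mul_term_coeff (P : ShiftOp τ) (i : ℤ) (c : ℤ → Charge N → Coef N) (j n : ℤ)
    (s : Charge N) :
    (P * term τ i c).coeff j n s = P.coeff (j - i) n s * c n (s + (j - i) • τ) := by
  rw [mul_coeff, tsum_eq_single (j - i)]
  · simp [term]
  · intro k hk
    have : j - k ≠ i := fun h => hk (by omega)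
    simp [term, this]

lemma term_mul_coeff (P : ShiftOp τ) (i : ℤ) (c : ℤ → Charge N → Coef N) (j n : ℤ)
    (s : Charge N) :
    (term τ i c * P).coeff j n s = c n s * P.coeff (j - i) n (s + i • τ) := by
  rw [mul_coeff, tsum_eq_single i]
  · simp [term]
  · intro k hk
    simp [term, hk]

lemma term_mul_term (i j : ℤ) (c e : ℤ → Charge N → Coef N) :
    term τ i c * term τ j e = term τ (i + j) fun n s => c n s * e n (s + i • τ) := by
  ext1; funext k n s
  rw [term_mul_coeff]
  have : k - i = j ↔ k = i + j := by omega
  simp only [term, this]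
  split_ifs <;> simp

lemma term_zero_pow (c : ℤ → Charge N → Coef N) (i : ℕ) :
    term τ 0 c ^ i = term τ 0 fun n s => c n s ^ i := by
  induction i with
  | zero => simp only [pow_zero]; rfl
  | succ i ih => rw [pow_succ, ih, term_mul_term]; simp [pow_succ]

lemma T_zpow (j : ℤ) : ((T τ ^ j : (ShiftOp τ)ˣ) : ShiftOp τ) = term τ j 1 := by
  induction j with
  | zero => rfl
  | succ j ih =>
    rw [zpow_add_one, Units.val_mul, ih, show (T τ : ShiftOp τ) = term τ 1 1 from rfl,
      term_mul_term]
    congr 1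
    funext n s
    exact mul_one _
  | pred j ih =>
    rw [zpow_sub_one, Units.val_mul, ih,
      show ((T τ)⁻¹ : (ShiftOp τ)ˣ).val = term τ (-1) 1 from rfl, term_mul_term]
    congr 1
    funext n s
    exact mul_one _

/-- In each order the support lies in a triangle: both indices are bounded above and their sum is
bounded below. -/
lemma summable_mul_mul (P Q : ShiftOp τ) (n : ℤ) (s : Charge N) {y : ℤ → Coef N}
    (hy : ∀ d, ∃ B : ℤ, ∀ e ≤ d, ∀ m < B, MvPowerSeries.coeff e (y m) = 0) :
    Summable fun x : ℤ × ℤ => P.coeff x.1 n s * Q.coeff x.2 n (s + x.1 • τ) * y (x.1 + x.2) := by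
  refine summable_of_finite fun d => ?_
  obtain ⟨B, hB⟩ := P.bounded' d
  obtain ⟨B', hB'⟩ := Q.bounded' d
  obtain ⟨B'', hB''⟩ := hy d
  refine ((Set.finite_Icc (B'' - B') B).prod (Set.finite_Icc (B'' - B) B')).subset fun x hx => ?_
  have h1 : x.1 ≤ B := by
    by_contra hcon
    exact hx (coeff_mul_eq_zero (Or.inl fun e he => coeff_mul_eq_zero (Or.inl fun e' he' =>
      hB e' (he'.trans he) _ (by omega) _ _)))
  have h2 : x.2 ≤ B' := by
    by_contra hcon
    exact hx (coeff_mul_eq_zero (Or.inl fun e he => coeff_mul_eq_zero (Or.inr fun e' he' =>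
      hB' e' (he'.trans he) _ (by omega) _ _)))
  have h3 : B'' ≤ x.1 + x.2 := by
    by_contra hcon
    exact hx (coeff_mul_eq_zero (Or.inr fun e he => hB'' e he _ (by omega)))
  simp only [Set.mem_prod, Set.mem_Icc]
  omega

lemma summable_mul_of_bdd (Q : ShiftOp τ) (n : ℤ) (s : Charge N) {y : ℤ → Coef N} (i : ℤ)
    (hy : ∀ d, ∃ B : ℤ, ∀ e ≤ d, ∀ m < B, MvPowerSeries.coeff e (y m) = 0) :
    Summable fun j => Q.coeff j n s * y (i + j) := by
  refine summable_of_finite fun d => ?_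
  obtain ⟨B', hB'⟩ := Q.bounded' d
  obtain ⟨B'', hB''⟩ := hy d
  refine (Set.finite_Icc (B'' - i) B').subset fun x hx => ?_
  have h2 : x ≤ B' := by
    by_contra hcon
    exact hx (coeff_mul_eq_zero (Or.inl fun e he => hB' e he _ (by omega) _ _))
  have h3 : B'' ≤ i + x := by
    by_contra hcon
    exact hx (coeff_mul_eq_zero (Or.inr fun e he => hB'' e he _ (by omega)))
  simp only [Set.mem_Icc]
  omega

lemma mul_mul_coeff (P Q R : ShiftOp τ) (J n : ℤ) (s : Charge N) :
    (P * Q * R).coeff J n s = ∑' x : ℤ × ℤ, P.coeff x.1 n s * Q.coeff x.2 n (s + x.1 • τ) *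
      R.coeff (J - (x.1 + x.2)) n (s + (x.1 + x.2) • τ) := by
  let y : ℤ → Coef N := fun m => R.coeff (J - m) n (s + m • τ)
  have hs := summable_mul_mul P Q n s (y := y) fun d => by
    obtain ⟨B, hB⟩ := R.bounded' d
    exact ⟨J - B, fun e he m hm => hB e he _ (by omega) _ _⟩
  exact (tsum_comp_eq P Q n s y hs).symm

/-- `F(n - ν_a + sg(a) s_a, T)`, with the coefficients on the left of the powers of `T`. -/
def ofSymbol [NeZero N] (τ : Charge N) (a : Idx N) (F : Symbol) : ShiftOp τ where
  coeff j n s := algebraMap ℂ (Coef N) (F.eval j ((n - nu a + sg a * s.1 a : ℤ) : ℂ))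
  bounded _ := by
    obtain ⟨J, hJ⟩ := F.exists_eval_eq_zero
    exact ⟨J, fun j hj n s => by rw [(hJ j hj).2, map_zero, map_zero]⟩

end ShiftOp

namespace Solution

variable [NeZero N] {𝔤 : LaurentAlgebra N} {sol : Solution 𝔤} {τ : Charge N} {a : Idx N}
  (hK : IsUnit (sol.K τ a))

/-- Multiplication by a function of `n` alone commutes with every scalar operator, since `T` moves
only the charges. Hence `n - ν_a` can be moved inside the conjugation, and powers of `ℳ_a` become
conjugates too. -/
lemma scalarM_eq : scalarM hK = (scalarW hK : ShiftOp τ) *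
    ShiftOp.term τ 0 (fun n s => ((n - nu a + sg a * s.1 a : ℤ) : Coef N)) *
      ((scalarW hK)⁻¹ : (ShiftOp τ)ˣ) := by
  have h1 : (ShiftOp.term τ 0 fun n s => ((n - nu a + sg a * s.1 a : ℤ) : Coef N)) =
      ShiftOp.term τ 0 (fun n _ => ((n - nu a : ℤ) : Coef N)) +
        sg a • ShiftOp.term τ 0 (fun _ s => ((s.1 a : ℤ) : Coef N)) := by
    ext1; funext j n s
    rcases a with a | a
    · rw [show sg (Sum.inl a : Idx N) = 1 from rfl, one_zsmul, ShiftOp.add_coeff]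
      simp only [ShiftOp.term]
      split_ifs <;> simp
    · rw [show sg (Sum.inr a : Idx N) = -1 from rfl, neg_one_zsmul, ShiftOp.add_coeff,
        ShiftOp.neg_coeff]
      simp only [ShiftOp.term]
      split_ifs <;> simp
  have h2 : (scalarW hK : ShiftOp τ) * ShiftOp.term τ 0 (fun n _ => ((n - nu a : ℤ) : Coef N)) =
      ShiftOp.term τ 0 (fun n _ => ((n - nu a : ℤ) : Coef N)) * (scalarW hK : ShiftOp τ) := by
    ext1; funext j n s
    rw [ShiftOp.mul_term_coeff, ShiftOp.term_mul_coeff, sub_zero, zero_smul, add_zero, mul_comm]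
  rw [h1, mul_add, add_mul, h2, mul_assoc (ShiftOp.term τ 0 _), Units.mul_inv, mul_one,
    mul_smul_comm, smul_mul_assoc]
  rfl

/-- The exponential of the times has coefficients independent of `n` and `s`, so it commutes with
`T`. -/
lemma scalarL_eq : scalarL hK = scalarW hK * ShiftOp.T τ * (scalarW hK)⁻¹ := by
  have h : ShiftOp.expT τ a * ShiftOp.T τ = ShiftOp.T τ * ShiftOp.expT τ a := by
    apply Units.ext
    ext1; funext j n s
    rw [Units.val_mul, Units.val_mul, show (ShiftOp.T τ : ShiftOp τ) = ShiftOp.term τ 1 1 from rfl,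
      ShiftOp.mul_term_coeff, ShiftOp.term_mul_coeff, mul_comm]
    rfl
  rw [scalarL, scalarW, mul_inv_rev, mul_assoc hK.unit (ShiftOp.expT τ a), h]
  group

lemma scalarM_pow_mul_scalarL_zpow (i : ℕ) (j : ℤ) :
    scalarM hK ^ i * ((scalarL hK ^ j : (ShiftOp τ)ˣ) : ShiftOp τ) =
      (scalarW hK : ShiftOp τ) *
        ShiftOp.term τ j (fun n s => ((n - nu a + sg a * s.1 a : ℤ) : Coef N) ^ i) *
        ((scalarW hK)⁻¹ : (ShiftOp τ)ˣ) := by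
  rw [scalarM_eq, scalarL_eq, conj_zpow, Units.conj_pow, ShiftOp.term_zero_pow, Units.val_mul,
    Units.val_mul, ShiftOp.T_zpow]
  have h : (ShiftOp.term τ j fun n s => ((n - nu a + sg a * s.1 a : ℤ) : Coef N) ^ i) =
      ShiftOp.term τ 0 (fun n s => ((n - nu a + sg a * s.1 a : ℤ) : Coef N) ^ i) *
        ShiftOp.term τ j 1 := by
    rw [ShiftOp.term_mul_term, zero_add]
    congr 1
    funext n s
    exact (mul_one _).symm
  rw [h]
  simp only [mul_assoc, Units.inv_mul_cancel_left]

/-- The operator `F(ℳ_a, ℒ_a)`, obtained by dressing. -/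
def dressedSymbol (F : Symbol) : ShiftOp τ :=
  (scalarW hK : ShiftOp τ) * ShiftOp.ofSymbol τ a F * ((scalarW hK)⁻¹ : (ShiftOp τ)ˣ)

lemma dressedSymbol_mul_scalarW (F : Symbol) :
    dressedSymbol hK F * (scalarW hK : ShiftOp τ) =
      (scalarW hK : ShiftOp τ) * ShiftOp.ofSymbol τ a F := by
  rw [dressedSymbol, Units.inv_mul_cancel_right]

lemma hasSum_scalarTerm (F : Symbol) :
    HasSum (scalarTerm hK F) (dressedSymbol hK F).coeff := by
  rw [Pi.hasSum]; intro J
  rw [Pi.hasSum]; intro n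
  rw [Pi.hasSum]; intro s
  set P : ShiftOp τ := (scalarW hK).val with hP
  set R : ShiftOp τ := ((scalarW hK)⁻¹).val with hR
  have e1 : ∀ q : ℕ × ℤ, scalarTerm hK F q J n s = F.coeff q.1 q.2 •
      ∑' u : ℤ, ((n - nu a + sg a * (s + u • τ).1 a : ℤ) : ℂ) ^ q.1 •
        (P.coeff u n s * R.coeff (J - (u + q.2)) n (s + (u + q.2) • τ)) := by
    intro q
    show F.coeff q.1 q.2 •
      (scalarM hK ^ q.1 * ((scalarL hK ^ q.2 : (ShiftOp τ)ˣ) : ShiftOp τ)).coeff J n s = _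
    rw [scalarM_pow_mul_scalarL_zpow, mul_assoc, ShiftOp.mul_coeff]
    congr 1
    refine tsum_congr fun u => ?_
    rw [ShiftOp.term_mul_coeff, add_assoc, ← add_smul, ← sub_sub, Algebra.smul_def, map_pow,
      map_intCast]
    ring
  have e2 : (dressedSymbol hK F).coeff J n s = ∑' x : ℤ × ℤ,
      F.eval x.2 ((n - nu a + sg a * (s + x.1 • τ).1 a : ℤ) : ℂ) •
        (P.coeff x.1 n s * R.coeff (J - (x.1 + x.2)) n (s + (x.1 + x.2) • τ)) := by
    rw [dressedSymbol, ShiftOp.mul_mul_coeff]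
    refine tsum_congr fun x => ?_
    rw [Algebra.smul_def, ← mul_assoc]
    congr 1
    exact mul_comm _ _
  rw [e2, funext e1]
  refine hasSum_symbol F (fun u => ((n - nu a + sg a * (s + u • τ).1 a : ℤ) : ℂ))
    (fun u j => P.coeff u n s * R.coeff (J - (u + j)) n (s + (u + j) • τ)) ?_
  intro d J0
  obtain ⟨B, hB⟩ := P.bounded' d
  obtain ⟨B', hB'⟩ := R.bounded' d
  refine ((Set.finite_Icc (J - B' - J0) B).prod (Set.finite_Icc (J - B' - B) J0)).subset ?_
  rintro ⟨u, j⟩ ⟨hj, hx⟩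
  have h1 : u ≤ B := by
    by_contra hcon
    exact hx (ShiftOp.coeff_mul_eq_zero (Or.inl fun e he => hB e he _ (by omega) _ _))
  have h2 : J - (u + j) ≤ B' := by
    by_contra hcon
    exact hx (ShiftOp.coeff_mul_eq_zero (Or.inr fun e he => hB' e he _ (by omega) _ _))
  simp only [Set.mem_prod, Set.mem_Icc] at hj ⊢
  omega

lemma scalarSeries_eq (F : Symbol) : scalarSeries hK F = (dressedSymbol hK F).coeff :=
  (hasSum_scalarTerm hK F).tsum_eq

end Solution

/-! ### Boundedness of the dressing operators -/

/-- The matrix column attached to an index. -/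
def column : Idx N → Fin N
  | Sum.inl k => k
  | Sum.inr k => k

namespace Solution

variable {𝔤 : LaurentAlgebra N} (sol : Solution 𝔤)

/-- The dressing operator `W` for unbarred indices and `W̄` for barred ones. -/
def dressing : Idx N → Charge N → 𝔤ˣ
  | Sum.inl _ => sol.W
  | Sum.inr _ => sol.Wbar

lemma W0_val (s : Charge N) : (sol.W0 s : 𝔤).1 =
    diagSeries 1 (fun k => expTimes (Sum.inl k)) fun k => s.1 (Sum.inl k) := by
  rw [sol.W0_eq, W0Series_eq]

lemma W0bar_val (s : Charge N) : (sol.W0bar s : 𝔤).1 =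
    diagSeries (-1) (fun k => expTimes (Sum.inr k)) fun k => s.1 (Sum.inr k) := by
  rw [sol.W0bar_eq, W0barSeries_eq]

lemma S_pos {s : Charge N} {X : 𝔤ˣ} (hX : X ∈ ({sol.S s, (sol.S s)⁻¹} : Set 𝔤ˣ)) (j n : ℤ)
    (hj : 0 < j) : (X : 𝔤).1 j n = 0 :=
  (sol.S_mem s X hX n).2 j hj

lemma Sbar_neg {s : Charge N} {X : 𝔤ˣ} (hX : X ∈ ({sol.Sbar s, (sol.Sbar s)⁻¹} : Set 𝔤ˣ))
    (j n : ℤ) (hj : j < 0) : (X : 𝔤).1 j n = 0 :=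
  sol.Sbar_mem s X hX n j hj

/-- The factors `S`, `S̄` and their inverses are one-sided. The exponentials are bounded in each
order because the coefficient of `y^m` has weight `m` in the times; `inv_diagSeries` shows that the
inverses of `W_0` and `W̄_0` are again such exponentials. -/
lemma shiftBdd_dressing (a : Idx N) (s : Charge N) :
    ShiftBdd (sg a) (sol.dressing a s : 𝔤).1 ∧
      ShiftBdd (sg a) (((sol.dressing a s)⁻¹ : 𝔤ˣ) : 𝔤).1 := by
  have hε := sg_mul_sg a
  have hinv : ∀ b : Idx N, expTimesInv b * expTimes b = 1 := fun b => by
    rw [mul_comm, ShiftOp.expTimes_mul_inv]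
  have hexp : ∀ b : Idx N, SeriesBdd (expTimes b) := fun b => ShiftOp.bounded_subst b _
  have hexpInv : ∀ b : Idx N, SeriesBdd (expTimesInv b) := fun b => ShiftOp.bounded_subst b _
  rcases a with k | k
  · have hS : ∀ X ∈ ({sol.S s, (sol.S s)⁻¹} : Set 𝔤ˣ), ShiftBdd 1 (X : 𝔤).1 := fun X hX =>
      ShiftBdd.of_forall rfl fun p n hp => sol.S_pos hX p n (by omega)
    constructor
    · refine ShiftBdd.mul hε (X := (sol.S s : 𝔤)) (Y := (sol.W0 s : 𝔤)) (hS _ (by simp)) ?_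
      rw [sol.W0_val]
      exact shiftBdd_diagSeries hε (fun k => hexp (Sum.inl k)) _
    · show ShiftBdd 1 (((sol.S s * sol.W0 s)⁻¹ : 𝔤ˣ) : 𝔤).1
      rw [mul_inv_rev, Units.val_mul]
      refine ShiftBdd.mul hε ?_ (hS _ (by simp))
      rw [inv_diagSeries hε (fun k => hexp (Sum.inl k)) (fun k => hexpInv (Sum.inl k))
        (fun k => hinv _) (sol.W0_val s)]
      exact shiftBdd_diagSeries hε (fun k => hexpInv (Sum.inl k)) _
  · have hS : ∀ X ∈ ({sol.Sbar s, (sol.Sbar s)⁻¹} : Set 𝔤ˣ), ShiftBdd (-1) (X : 𝔤).1 :=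
      fun X hX => ShiftBdd.of_forall rfl fun p n hp => sol.Sbar_neg hX p n (by omega)
    constructor
    · refine ShiftBdd.mul hε (X := (sol.Sbar s : 𝔤)) (Y := (sol.W0bar s : 𝔤)) (hS _ (by simp)) ?_
      rw [sol.W0bar_val]
      exact shiftBdd_diagSeries hε (fun k => hexp (Sum.inr k)) _
    · show ShiftBdd (-1) (((sol.Sbar s * sol.W0bar s)⁻¹ : 𝔤ˣ) : 𝔤).1
      rw [mul_inv_rev, Units.val_mul]
      refine ShiftBdd.mul hε ?_ (hS _ (by simp))
      rw [inv_diagSeries hε (fun k => hexp (Sum.inr k)) (fun k => hexpInv (Sum.inr k))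
        (fun k => hinv _) (sol.W0bar_val s)]
      exact shiftBdd_diagSeries hε (fun k => hexpInv (Sum.inr k)) _

/-- The coefficients of the scalar wave operator are the entries of the first row of the dressing
operator. -/
lemma scalarW_coeff [NeZero N] {sol : Solution 𝔤} {τ : Charge N} {a : Idx N}
    (hK : IsUnit (sol.K τ a)) (p n : ℤ) (s : Charge N) :
    (scalarW hK).val.coeff (sg a * p + (nu a - s.1 a)) n s =
      (sol.dressing a s : 𝔤).1 p n 0 (column a) := by
  have h : ∀ m, (scalarW hK).val.coeff m n s =
      ∑' i, (sol.K τ a).coeff i n s * intCoeff (expTimes a) (m - i) := fun m => rfl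
  rw [h]
  rcases a with k | k
  · have hW := hasSum_mul_apply (sol.S s : 𝔤) (sol.W0 s : 𝔤) p n 0 k
    refine Eq.trans ?_ hW.tsum_eq
    -- For `k ≠ 1` the coefficient of `T^j` in `𝒦_k` comes from `Λ^{j-1}` in `S`; the offset `ν_a`
    -- compensates.
    rw [← (Equiv.addRight (nu (Sum.inl k : Idx N))).tsum_eq]
    refine tsum_congr fun i => ?_
    rw [Finset.sum_eq_single k]
    · rw [sol.W0_val]
      simp only [diagSeries, Matrix.diagonal_apply_eq, Equiv.coe_addRight]
      congr 1
      · simp only [K, nu]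
        by_cases hk : k = 0
        · subst hk
          simp only [if_true, add_zero]
          split_ifs with hi
          · rw [sol.S_pos (s := s) (by simp) _ _ hi, Matrix.zero_apply]
          · rfl
        · simp only [if_neg hk, add_sub_cancel_right]
          split_ifs with hi
          -- Nothing is lost by starting `𝒦_k` at `φ_1`: the leading coefficient of `S` is the
          -- identity, whose `(1,k)` entry is zero.
          · rcases (show 0 ≤ i by omega).eq_or_lt with rfl | hi'
            · rw [(sol.S_mem s _ (by simp) n).1, Matrix.one_apply_ne (Ne.symm hk)]
            · rw [sol.S_pos (s := s) (by simp) _ _ hi', Matrix.zero_apply]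
          · rfl
      · congr 1
        simp only [sg]
        ring
    · intro l _ hl
      rw [sol.W0_val]
      simp only [diagSeries]
      rw [Matrix.diagonal_apply_ne _ hl, mul_zero]
    · simp
  · have hW := hasSum_mul_apply (sol.Sbar s : 𝔤) (sol.W0bar s : 𝔤) p n 0 k
    refine Eq.trans ?_ hW.tsum_eq
    -- Powers of `T⁻¹` in `𝒦_k̄` correspond to powers of `Λ` in `S̄`.
    rw [← (Equiv.neg ℤ).tsum_eq]
    refine tsum_congr fun i => ?_
    rw [Finset.sum_eq_single k]
    · rw [sol.W0bar_val]
      simp only [diagSeries, Matrix.diagonal_apply_eq, Equiv.neg_apply]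
      congr 1
      · simp only [K, neg_neg]
        split_ifs with hi
        · rw [sol.Sbar_neg (s := s) (by simp) _ _ (by omega), Matrix.zero_apply]
        · rfl
      · congr 1
        simp only [sg, nu]
        ring
    · intro l _ hl
      rw [sol.W0bar_val]
      simp only [diagSeries]
      rw [Matrix.diagonal_apply_ne _ hl, mul_zero]
    · simp

end Solution

/-! ### The matrix series `F(M, L) C_{kk}` -/

lemma symbolTerm_dressed {𝔤 : LaurentAlgebra N} (F : Symbol) (V : 𝔤ˣ) (ε : ℤ) (k : Fin N)
    (q : ℕ × ℤ) (J n : ℤ) (r c : Fin N) :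
    symbolTerm F (V.val * 𝔤.position * (V⁻¹ : 𝔤ˣ).val) (V * 𝔤.shift ^ ε * V⁻¹)
      (V.val * 𝔤.matrixUnit k k * (V⁻¹ : 𝔤ˣ).val) q J n r c = F.coeff q.1 q.2 •
      ∑' p : ℤ, ((n + p : ℤ) : ℂ) ^ q.1 • (V.val.1 p n r k *
        (V⁻¹ : 𝔤ˣ).val.1 (J - p - ε * q.2) (n + p + ε * q.2) k c) := by
  have h : (V.val * 𝔤.position * (V⁻¹ : 𝔤ˣ).val) ^ q.1 *
      ((V * 𝔤.shift ^ ε * V⁻¹) ^ q.2 : 𝔤ˣ).val * (V.val * 𝔤.matrixUnit k k * (V⁻¹ : 𝔤ˣ).val) =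
      V.val * (𝔤.position ^ q.1 * ((𝔤.shift ^ (ε * q.2) : 𝔤ˣ) : 𝔤) * 𝔤.matrixUnit k k) *
        (V⁻¹ : 𝔤ˣ).val := by
    rw [conj_zpow, Units.conj_pow, zpow_mul]
    simp only [Units.val_mul, mul_assoc, Units.inv_mul_cancel_left]
  show F.coeff q.1 q.2 • (_ * _ * _ : 𝔤).1 J n r c = _
  rw [h, ← (hasSum_mul_single_mul (position_pow_mul_shift_zpow_mul_matrixUnit_val q.1 (ε * q.2) k)
    V.val (V⁻¹ : 𝔤ˣ).val J n r c).tsum_eq]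
  congr 1
  refine tsum_congr fun p => ?_
  rw [Algebra.smul_def, map_pow, map_intCast]

lemma hasSum_symbolTerm_dressed {𝔤 : LaurentAlgebra N} (F : Symbol) (V : 𝔤ˣ) {ε : ℤ}
    (hε : ε * ε = 1) (hV : ShiftBdd ε V.val.1) (hV' : ShiftBdd ε (V⁻¹ : 𝔤ˣ).val.1) (k : Fin N) :
    HasSum (symbolTerm F (V.val * 𝔤.position * (V⁻¹ : 𝔤ˣ).val) (V * 𝔤.shift ^ ε * V⁻¹)
      (V.val * 𝔤.matrixUnit k k * (V⁻¹ : 𝔤ˣ).val))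
      fun J n => Matrix.of fun r c => ∑' x : ℤ × ℤ, F.eval x.2 ((n + x.1 : ℤ) : ℂ) •
        (V.val.1 x.1 n r k *
          (V⁻¹ : 𝔤ˣ).val.1 (J - x.1 - ε * x.2) (n + x.1 + ε * x.2) k c) := by
  refine Pi.hasSum.2 fun J => Pi.hasSum.2 fun n => Pi.hasSum.2 fun r => Pi.hasSum.2 fun c => ?_
  simp only [Matrix.of_apply]
  rw [funext fun q => symbolTerm_dressed F V ε k q J n r c]
  refine hasSum_symbol F (fun p => ((n + p : ℤ) : ℂ)) (fun p j => V.val.1 p n r k *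
    (V⁻¹ : 𝔤ˣ).val.1 (J - p - ε * j) (n + p + ε * j) k c) fun d J0 => ?_
  obtain ⟨B, hB⟩ := hV.le d
  obtain ⟨B', hB'⟩ := hV'.le d
  have h1 : ∀ x ∈ {p : ℤ × ℤ | p.2 ≤ J0 ∧ MvPowerSeries.coeff d (V.val.1 p.1 n r k *
      (V⁻¹ : 𝔤ˣ).val.1 (J - p.1 - ε * p.2) (n + p.1 + ε * p.2) k c) ≠ 0},
      ε * x.1 ∈ Set.Icc (ε * J - B' - J0) B ∧ x.2 ∈ Set.Icc (ε * J - B' - B) J0 := by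
    rintro ⟨p, j⟩ ⟨hj, hx⟩
    have h1 : ε * p ≤ B := by
      by_contra hcon
      refine hx (ShiftOp.coeff_mul_eq_zero (Or.inl fun e he => ?_))
      have := hB e he (ε * p) (by omega) (n, r, k)
      simpa only [← mul_assoc, hε, one_mul] using this
    have h2 : ε * J - ε * p - j ≤ B' := by
      by_contra hcon
      refine hx (ShiftOp.coeff_mul_eq_zero (Or.inr fun e he => ?_))
      have := hB' e he (ε * J - ε * p - j) (by omega) (n + p + ε * j, k, c)
      simpa only [mul_sub, ← mul_assoc, hε, one_mul] using this
    simp only [Set.mem_Icc] at hj ⊢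
    omega
  refine Set.Finite.subset (((Set.finite_Icc (ε * J - B' - J0) B).image (ε * ·)).prod
    (Set.finite_Icc (ε * J - B' - B) J0)) fun x hx => ⟨⟨ε * x.1, (h1 x hx).1, ?_⟩, (h1 x hx).2⟩
  show ε * (ε * x.1) = x.1
  rw [← mul_assoc, hε, one_mul]

/-! ### The kernels `V(s') E_{kk} V(s)⁻¹` and their pairing with scalar operators. -/

lemma sg_mul_nu [NeZero N] (a : Idx N) : sg a * nu a = nu a := by
  rcases a with k | k <;> simp [sg, nu]

namespace Solution

variable {𝔤 : LaurentAlgebra N} {sol : Solution 𝔤} {τ : Charge N} {a : Idx N}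

/-- `V(s') E_{kk} V(s)⁻¹`, the contribution of a single column to `V(s') V(s)⁻¹`. -/
def kernel (sol : Solution 𝔤) (a : Idx N) (s' s : Charge N) : 𝔤 :=
  (sol.dressing a s').val * 𝔤.matrixUnit (column a) (column a) * ((sol.dressing a s)⁻¹).val

lemma kernel_apply (s' s : Charge N) (J n : ℤ) (r c : Fin N) :
    (sol.kernel a s' s).1 J n r c =
      ∑' p, (sol.dressing a s').val.1 p n r (column a) *
        ((sol.dressing a s)⁻¹).val.1 (J - p) (n + p) (column a) c := by
  have hZ : (𝔤.matrixUnit (column a) (column a)).1 =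
      monomialShift 0 fun _ => (1 : Coef N) • Matrix.single (column a) (column a) 1 := by
    simp only [one_smul]; rfl
  rw [kernel, ← (hasSum_mul_single_mul hZ _ _ J n r c).tsum_eq]
  refine tsum_congr fun p => ?_
  rw [one_mul, sub_zero, add_zero]

/-- The matrix series `F(M, L) C_{kk}` of unbarred and `F(M̄, L̄⁻¹) C̄_{kk}` of barred type. -/
lemma hasSum_symbolTerm (sol : Solution 𝔤) (F : Symbol) (a : Idx N) (s : Charge N) :
    HasSum (symbolTerm F
        ((sol.dressing a s).val * 𝔤.position * ((sol.dressing a s)⁻¹).val)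
        (sol.dressing a s * 𝔤.shift ^ sg a * (sol.dressing a s)⁻¹)
        ((sol.dressing a s).val * 𝔤.matrixUnit (column a) (column a) *
          ((sol.dressing a s)⁻¹).val))
      fun J n => Matrix.of fun r c => ∑' x : ℤ × ℤ, F.eval x.2 ((n + x.1 : ℤ) : ℂ) •
        ((sol.dressing a s).val.1 x.1 n r (column a) *
          ((sol.dressing a s)⁻¹).val.1 (J - x.1 - sg a * x.2) (n + x.1 + sg a * x.2)
            (column a) c) :=
  hasSum_symbolTerm_dressed F _ (sg_mul_sg a) (sol.shiftBdd_dressing a s).1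
    (sol.shiftBdd_dressing a s).2 _

lemma hasSum_symbolTerm_inl (sol : Solution 𝔤) (F : Symbol) (k : Fin N) (s : Charge N) :
    HasSum (symbolTerm F (sol.M s) (sol.L s) (sol.C s k))
      fun J n => Matrix.of fun r c => ∑' x : ℤ × ℤ, F.eval x.2 ((n + x.1 : ℤ) : ℂ) •
        ((sol.dressing (Sum.inl k) s).val.1 x.1 n r k *
          ((sol.dressing (Sum.inl k) s)⁻¹).val.1 (J - x.1 - sg (Sum.inl k : Idx N) * x.2)
            (n + x.1 + sg (Sum.inl k : Idx N) * x.2) k c) := by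
  have h := sol.hasSum_symbolTerm F (Sum.inl k) s
  rw [show sol.dressing (Sum.inl k) s * 𝔤.shift ^ sg (Sum.inl k : Idx N) *
    (sol.dressing (Sum.inl k) s)⁻¹ = sol.L s from by
      rw [show sg (Sum.inl k : Idx N) = 1 from rfl, zpow_one]; rfl] at h
  exact h

lemma hasSum_symbolTerm_inr (sol : Solution 𝔤) (F : Symbol) (k : Fin N) (s : Charge N) :
    HasSum (symbolTerm F (sol.Mbar s) (sol.Lbar s)⁻¹ (sol.Cbar s k))
      fun J n => Matrix.of fun r c => ∑' x : ℤ × ℤ, F.eval x.2 ((n + x.1 : ℤ) : ℂ) •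
        ((sol.dressing (Sum.inr k) s).val.1 x.1 n r k *
          ((sol.dressing (Sum.inr k) s)⁻¹).val.1 (J - x.1 - sg (Sum.inr k : Idx N) * x.2)
            (n + x.1 + sg (Sum.inr k : Idx N) * x.2) k c) := by
  have h := sol.hasSum_symbolTerm F (Sum.inr k) s
  rw [show sol.dressing (Sum.inr k) s * 𝔤.shift ^ sg (Sum.inr k : Idx N) *
    (sol.dressing (Sum.inr k) s)⁻¹ = (sol.Lbar s)⁻¹ from by
      rw [show sg (Sum.inr k : Idx N) = -1 from rfl, zpow_neg_one, Lbar, ← conj_inv]; rfl] at h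
  exact h

/-- The first row of `F(M, L) C_{kk}` through the coefficients of `F(ℳ_a, ℒ_a)`. -/
lemma tsum_dressedSymbol_mul_kernel [NeZero N] (hK : IsUnit (sol.K τ a)) (hτ : τ.1 a = 1)
    (F : Symbol) (s : Charge N) (J n : ℤ) (c : Fin N) :
    ∑' x : ℤ × ℤ, F.eval x.2 ((n + x.1 : ℤ) : ℂ) • ((sol.dressing a s).val.1 x.1 n 0 (column a) *
        ((sol.dressing a s)⁻¹).val.1 (J - x.1 - sg a * x.2) (n + x.1 + sg a * x.2) (column a) c) =
      ∑' i, (dressedSymbol hK F).coeff i n s * (sol.kernel a (s + i • τ) s).1 J n 0 c := by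
  have hε := sg_mul_sg a
  set e : ℤ := nu a - s.1 a with he
  -- The remaining factor `V(s)⁻¹`, indexed by the degree `m = sg(a) p + e` that `scalarW_coeff`
  -- assigns to `Λ^p`.
  let y : ℤ → Coef N := fun m =>
    ((sol.dressing a s)⁻¹).val.1 (J - sg a * (m - e)) (n + sg a * (m - e)) (column a) c
  have hy : ∀ d, ∃ B : ℤ, ∀ e ≤ d, ∀ m < B, MvPowerSeries.coeff e (y m) = 0 := by
    intro d
    obtain ⟨B, hB⟩ := (sol.shiftBdd_dressing a s).2.le d
    refine ⟨sg a * J + e - B, fun e' he' m hm => ?_⟩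
    have := hB e' he' (sg a * J - (m - e)) (by omega) (n + sg a * (m - e), column a, c)
    simp only [mul_sub (sg a) (sg a * J), ← mul_assoc, hε, one_mul] at this
    exact this
  have hsW : ∀ (i : ℤ), (s + i • τ).1 a = s.1 a + i := fun i => by
    show s.1 a + i • τ.1 a = _
    rw [hτ, smul_eq_mul, mul_one]
  calc _ = ∑' x : ℤ × ℤ, (scalarW hK).val.coeff x.1 n s *
        (ShiftOp.ofSymbol τ a F).coeff x.2 n (s + x.1 • τ) * y (x.1 + x.2) := by
        rw [← ((affineEquiv (sg a) hε e).prodCongr (Equiv.refl ℤ)).tsum_eq (fun x : ℤ × ℤ =>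
          (scalarW hK).val.coeff x.1 n s *
          (ShiftOp.ofSymbol τ a F).coeff x.2 n (s + x.1 • τ) * y (x.1 + x.2))]
        refine tsum_congr fun x => ?_
        show _ = (scalarW hK).val.coeff (sg a * x.1 + e) n s *
          (ShiftOp.ofSymbol τ a F).coeff x.2 n (s + (sg a * x.1 + e) • τ) * y (sg a * x.1 + e + x.2)
        rw [scalarW_coeff]
        -- In degree `sg(a) p + e` the charge `s_a` has become `sg(a) p + ν_a`, so the argument of
        -- the symbol is `n + p`, as on the matrix side. This fixes the value of `ν_a` in `ℳ_a`.
        have h1 : n - nu a + sg a * (s + (sg a * x.1 + e) • τ).1 a = n + x.1 := by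
          rw [hsW, he]
          linear_combination x.1 * hε + sg_mul_nu a
        have h2 : sg a * (sg a * x.1 + e + x.2 - e) = x.1 + sg a * x.2 := by
          linear_combination x.1 * hε
        simp only [ShiftOp.ofSymbol, y, h1, h2]
        rw [Algebra.smul_def, sub_sub, add_assoc]
        ring
    _ = ∑' m, ((scalarW hK).val * ShiftOp.ofSymbol τ a F).coeff m n s * y m :=
        tsum_comp_eq _ _ n s y (ShiftOp.summable_mul_mul _ _ _ _ hy)
    _ = ∑' m, (dressedSymbol hK F * (scalarW hK).val).coeff m n s * y m := by
        rw [dressedSymbol_mul_scalarW]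
    _ = ∑' i, (dressedSymbol hK F).coeff i n s *
          ∑' j, (scalarW hK).val.coeff j n (s + i • τ) * y (i + j) :=
        (tsum_tsum_comp_eq _ _ n s y (ShiftOp.summable_mul_mul _ _ _ _ hy) fun i =>
          ShiftOp.summable_mul_of_bdd _ _ _ _ hy).symm
    _ = _ := by
        refine tsum_congr fun i => ?_
        rw [kernel_apply, ← (affineEquiv (sg a) hε (nu a - (s + i • τ).1 a)).tsum_eq]
        congr 1
        refine tsum_congr fun p => ?_
        show (scalarW hK).val.coeff (sg a * p + (nu a - (s + i • τ).1 a)) n (s + i • τ) *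
          y (i + (sg a * p + (nu a - (s + i • τ).1 a))) = _
        rw [scalarW_coeff]
        -- The degree offset at `s + iτ` is `e - i`, which absorbs the `i` coming from `T^i`.
        have h2 : sg a * (i + (sg a * p + (nu a - (s + i • τ).1 a)) - e) = p := by
          rw [hsW, he]
          linear_combination p * hε
        simp only [y, h2]

end Solution

lemma add_zsmul_transfer_apply (s : Charge N) (i : ℤ) (a b c : Idx N) :
    (s + i • transfer a b).1 c =
      s.1 c + ((if c = a then i else 0) - (if c = b then i else 0)) := by
  show s.1 c + i • ((Pi.single a 1 : Idx N → ℤ) c - (Pi.single b 1 : Idx N → ℤ) c) = _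
  rw [Pi.single_apply, Pi.single_apply]
  split_ifs <;> simp

lemma transfer_apply_self {a b : Idx N} (h : a ≠ b) : (transfer a b).1 a = 1 := by
  show (Pi.single a 1 : Idx N → ℤ) a - (Pi.single b 1 : Idx N → ℤ) a = 1
  simp [h]

/-! ### Truncations of the kernels -/

namespace Solution

section Kernels

variable {𝔤 : LaurentAlgebra N} (sol : Solution 𝔤)

lemma sub_one_of_neg (X : 𝔤) {J : ℤ} (hJ : J < 0) (n : ℤ) (r c : Fin N) :
    (X - 1).1 J n r c = X.1 J n r c := by
  show X.1 J n r c - (1 : 𝔤).1 J n r c = _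
  rw [one_val, if_neg hJ.ne, Matrix.zero_apply, sub_zero]

/-- `W(s') W(s)⁻¹ = W̄(s') W̄(s)⁻¹`. -/
def transition (s' s : Charge N) : 𝔤 := (sol.W s').val * ((sol.W s)⁻¹).val

lemma transition_eq (s' s : Charge N) :
    sol.transition s' s = (sol.Wbar s').val * ((sol.Wbar s)⁻¹).val := by
  have h : ∀ s, sol.Wbar s = sol.W s * sol.g := fun s => (sol.factorization s).symm
  rw [transition, ← Units.val_mul, ← Units.val_mul, h, h]
  congr 1
  group

/-- Here the factorization problem enters: one element moves both `W` and `W̄` from `s` to `s'`,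
because `g` cancels in `transition_eq`. -/
lemma transition_mul_dressing (s' s : Charge N) (a : Idx N) :
    sol.transition s' s * (sol.dressing a s).val = (sol.dressing a s').val := by
  rcases a with k | k
  · exact Units.inv_mul_cancel_right _ _
  · rw [transition_eq]
    exact Units.inv_mul_cancel_right _ _

/-- Inserting `1 = ∑ E_ll` on the unbarred side controls the nonnegative powers of the transition;
`sum_kernel_inr` does the same on the barred side for the negative ones. -/
lemma sum_kernel_inl (s' s : Charge N) :
    ∑ l, sol.kernel (Sum.inl l) s' s = sol.transition s' s := by
  show ∑ l, (sol.W s').val * 𝔤.matrixUnit l l * ((sol.W s)⁻¹).val = _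
  rw [← Finset.sum_mul, ← Finset.mul_sum, sum_matrixUnit, mul_one, transition]

lemma sum_kernel_inr (s' s : Charge N) :
    ∑ l, sol.kernel (Sum.inr l) s' s = sol.transition s' s := by
  show ∑ l, (sol.Wbar s').val * 𝔤.matrixUnit l l * ((sol.Wbar s)⁻¹).val = _
  rw [← Finset.sum_mul, ← Finset.mul_sum, sum_matrixUnit, mul_one, transition_eq]

/-- The time exponentials at `s'` and `s` coincide and cancel, leaving `S(s') Λ^{s'_l - s_l} E_ll
S(s)⁻¹`. -/
lemma hasSum_kernel_inl (l : Fin N) (s' s : Charge N) (J n : ℤ) (r c : Fin N) :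
    HasSum (fun p => (sol.S s' : 𝔤).1 p n r l * ((sol.S s)⁻¹).val.1
      (J - p - (s'.1 (Sum.inl l) - s.1 (Sum.inl l)))
      (n + p + (s'.1 (Sum.inl l) - s.1 (Sum.inl l))) l c)
      ((sol.kernel (Sum.inl l) s' s).1 J n r c) := by
  have h : sol.kernel (Sum.inl l) s' s = (sol.S s').val *
      (((𝔤.shift ^ (s'.1 (Sum.inl l) - s.1 (Sum.inl l)) : 𝔤ˣ) : 𝔤) * 𝔤.matrixUnit l l) *
        ((sol.S s)⁻¹).val := by
    have h1 := diagSeries_mul_matrixUnit (ε := 1) rfl (sol.W0_val s) (sol.W0_val s') l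
    rw [one_mul] at h1
    show (sol.S s' * sol.W0 s').val * 𝔤.matrixUnit l l * ((sol.S s * sol.W0 s)⁻¹).val = _
    rw [Units.val_mul, mul_assoc (sol.S s').val, h1, mul_inv_rev, Units.val_mul]
    simp only [mul_assoc, Units.mul_inv_cancel_left]
  rw [h]
  simpa only [one_mul] using
    hasSum_mul_single_mul (shift_zpow_mul_matrixUnit_val _ l) (sol.S s').val _ J n r c

lemma hasSum_kernel_inr (l : Fin N) (s' s : Charge N) (J n : ℤ) (r c : Fin N) :
    HasSum (fun p => (sol.Sbar s' : 𝔤).1 p n r l * ((sol.Sbar s)⁻¹).val.1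
      (J - p - -(s'.1 (Sum.inr l) - s.1 (Sum.inr l)))
      (n + p + -(s'.1 (Sum.inr l) - s.1 (Sum.inr l))) l c)
      ((sol.kernel (Sum.inr l) s' s).1 J n r c) := by
  have h : sol.kernel (Sum.inr l) s' s = (sol.Sbar s').val *
      (((𝔤.shift ^ (-(s'.1 (Sum.inr l) - s.1 (Sum.inr l))) : 𝔤ˣ) : 𝔤) * 𝔤.matrixUnit l l) *
        ((sol.Sbar s)⁻¹).val := by
    have h1 := diagSeries_mul_matrixUnit (ε := -1) rfl (sol.W0bar_val s) (sol.W0bar_val s') l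
    rw [neg_one_mul] at h1
    show (sol.Sbar s' * sol.W0bar s').val * 𝔤.matrixUnit l l *
      ((sol.Sbar s * sol.W0bar s)⁻¹).val = _
    rw [Units.val_mul, mul_assoc (sol.Sbar s').val, h1, mul_inv_rev, Units.val_mul]
    simp only [mul_assoc, Units.mul_inv_cancel_left]
  rw [h]
  simpa only [one_mul] using
    hasSum_mul_single_mul (shift_zpow_mul_matrixUnit_val _ l) (sol.Sbar s').val _ J n r c

/-- The lowest possible power is `Λ^{-(s'_l̄ - s_l̄)}`, because `S̄` and `S̄⁻¹` contain no negative
powers. -/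
lemma kernel_inr_eq_zero {l : Fin N} {s' s : Charge N} (h : s'.1 (Sum.inr l) ≤ s.1 (Sum.inr l))
    {J : ℤ} (hJ : J < 0) (n : ℤ) (r c : Fin N) :
    (sol.kernel (Sum.inr l) s' s).1 J n r c = 0 := by
  refine (sol.hasSum_kernel_inr l s' s J n r c).unique ?_
  convert hasSum_zero using 2 with p
  by_cases hp : p < 0
  · rw [sol.Sbar_neg (s := s') (by simp) _ _ hp, Matrix.zero_apply, zero_mul]
  · rw [sol.Sbar_neg (s := s) (X := (sol.Sbar s)⁻¹) (by simp) _ _ (by omega), Matrix.zero_apply,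
      mul_zero]

variable [NeZero N]

/-- The top term is `E_ll Λ^{s'_l - s_l}`. When the charge is unchanged it has degree zero, but its
first row vanishes for `l ≠ 1`. -/
lemma kernel_inl_eq_zero {l : Fin N} {s' s : Charge N}
    (h : s'.1 (Sum.inl l) < s.1 (Sum.inl l) ∨ s'.1 (Sum.inl l) ≤ s.1 (Sum.inl l) ∧ l ≠ 0)
    {J : ℤ} (hJ : 0 ≤ J) (n : ℤ) (c : Fin N) :
    (sol.kernel (Sum.inl l) s' s).1 J n 0 c = 0 := by
  refine (sol.hasSum_kernel_inl l s' s J n 0 c).unique ?_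
  convert hasSum_zero using 2 with p
  rcases lt_trichotomy p 0 with hp | rfl | hp
  · rw [sol.S_pos (s := s) (X := (sol.S s)⁻¹) (by simp) _ _ (by omega), Matrix.zero_apply,
      mul_zero]
  · rcases h with h | h
    · rw [sol.S_pos (s := s) (X := (sol.S s)⁻¹) (by simp) _ _ (by omega), Matrix.zero_apply,
      mul_zero]
    · rw [(sol.S_mem s' _ (by simp) n).1, Matrix.one_apply_ne h.2.symm, zero_mul]
  · rw [sol.S_pos (s := s') (by simp) _ _ hp, Matrix.zero_apply, zero_mul]

lemma kernel_inl_zero_eq_one {s' s : Charge N} (h : s'.1 (Sum.inl 0) = s.1 (Sum.inl 0))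
    {J : ℤ} (hJ : 0 ≤ J) (n : ℤ) (c : Fin N) :
    (sol.kernel (Sum.inl 0) s' s).1 J n 0 c = (1 : 𝔤).1 J n 0 c := by
  rw [(sol.hasSum_kernel_inl 0 s' s J n 0 c).unique (hasSum_single 0 fun p hp => ?_)]
  · rw [(sol.S_mem s' _ (by simp) n).1, Matrix.one_apply_eq, one_mul, h, sub_self, sub_zero,
      sub_zero, add_zero, add_zero, one_val]
    split_ifs with hJ0
    · rw [hJ0, (sol.S_mem s (sol.S s)⁻¹ (by simp) n).1]
    · rw [sol.S_pos (s := s) (X := (sol.S s)⁻¹) (by simp) _ _ (by omega)]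
  · rcases lt_or_gt_of_ne hp with hp | hp
    · rw [sol.S_pos (s := s) (X := (sol.S s)⁻¹) (by simp) _ _ (by omega), Matrix.zero_apply,
        mul_zero]
    · rw [sol.S_pos (s := s') (by simp) _ _ hp, Matrix.zero_apply, zero_mul]

lemma transition_inl {k : Fin N} {s' s : Charge N} {J : ℤ} (hJ : 0 ≤ J)
    (hl : ∀ l ≠ k, s'.1 (Sum.inl l) < s.1 (Sum.inl l) ∨
      s'.1 (Sum.inl l) ≤ s.1 (Sum.inl l) ∧ l ≠ 0) (n : ℤ) (c : Fin N) :
    (sol.transition s' s).1 J n 0 c = (sol.kernel (Sum.inl k) s' s).1 J n 0 c := by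
  rw [← sum_kernel_inl, sum_val, Matrix.sum_apply]
  exact Finset.sum_eq_single k (fun l _ h => sol.kernel_inl_eq_zero (hl l h) hJ n c) (by simp)

/-- With `s_1` unchanged, column `1` still contributes the first row of the identity; this is what
the subtracted `1` in the projection removes. -/
lemma transition_inl_sub_one {k : Fin N} {s' s : Charge N} {J : ℤ} (hJ : 0 ≤ J) (hk : k ≠ 0)
    (hl : ∀ l ≠ k, s'.1 (Sum.inl l) ≤ s.1 (Sum.inl l))
    (h0 : s'.1 (Sum.inl 0) = s.1 (Sum.inl 0)) (n : ℤ) (c : Fin N) :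
    (sol.transition s' s - 1).1 J n 0 c = (sol.kernel (Sum.inl k) s' s).1 J n 0 c := by
  show (sol.transition s' s).1 J n 0 c - (1 : 𝔤).1 J n 0 c = _
  rw [sub_eq_iff_eq_add, ← sol.kernel_inl_zero_eq_one h0 hJ, ← sum_kernel_inl, sum_val,
    Matrix.sum_apply]
  exact Finset.sum_eq_add k 0 hk
    (fun l _ h => sol.kernel_inl_eq_zero (Or.inr ⟨hl l h.1, h.2⟩) hJ n c)
    (by simp) (by simp)

lemma transition_inr {k : Fin N} {s' s : Charge N} {J : ℤ} (hJ : J < 0)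
    (hl : ∀ l ≠ k, s'.1 (Sum.inr l) ≤ s.1 (Sum.inr l)) (n : ℤ) (c : Fin N) :
    (sol.transition s' s).1 J n 0 c = (sol.kernel (Sum.inr k) s' s).1 J n 0 c := by
  rw [← sum_kernel_inr, sum_val, Matrix.sum_apply]
  exact Finset.sum_eq_single k (fun l _ h => sol.kernel_inr_eq_zero (hl l h) hJ n 0 c) (by simp)

lemma transition_of_neg {s' s : Charge N} {J : ℤ} (hJ : J < 0)
    (hl : ∀ l, s'.1 (Sum.inr l) ≤ s.1 (Sum.inr l)) (n : ℤ) (c : Fin N) :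
    (sol.transition s' s).1 J n 0 c = 0 := by
  rw [← sum_kernel_inr, sum_val, Matrix.sum_apply]
  exact Finset.sum_eq_zero fun l _ => sol.kernel_inr_eq_zero (hl l) hJ n 0 c

lemma transition_of_nonneg {s' s : Charge N} {J : ℤ} (hJ : 0 ≤ J)
    (hl : ∀ l ≠ 0, s'.1 (Sum.inl l) ≤ s.1 (Sum.inl l))
    (h0 : s'.1 (Sum.inl 0) < s.1 (Sum.inl 0)) (n : ℤ) (c : Fin N) :
    (sol.transition s' s).1 J n 0 c = 0 := by
  rw [← sum_kernel_inl, sum_val, Matrix.sum_apply]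
  refine Finset.sum_eq_zero fun l _ => sol.kernel_inl_eq_zero ?_ hJ n c
  by_cases h : l = 0
  · exact Or.inl (h ▸ h0)
  · exact Or.inr ⟨hl l h, h⟩

lemma transition_sub_one_of_nonneg {s' s : Charge N} {J : ℤ} (hJ : 0 ≤ J)
    (hl : ∀ l ≠ 0, s'.1 (Sum.inl l) ≤ s.1 (Sum.inl l))
    (h0 : s'.1 (Sum.inl 0) = s.1 (Sum.inl 0)) (n : ℤ) (c : Fin N) :
    (sol.transition s' s - 1).1 J n 0 c = 0 := by
  show (sol.transition s' s).1 J n 0 c - (1 : 𝔤).1 J n 0 c = _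
  rw [sub_eq_zero, ← sol.kernel_inl_zero_eq_one h0 hJ]
  exact sol.transition_inl hJ (fun l h => Or.inr ⟨hl l h, h⟩) n c

end Kernels

/-! ### The kernels of the projections -/

variable [NeZero N] {𝔤 : LaurentAlgebra N}

/-- The element of `𝔤` that acts on `W` as the projection of `𝒯_a^i`. -/
def unbarredKernel (sol : Solution 𝔤) (a₀ a : Idx N) (s : Charge N) (i : ℤ) : 𝔤 :=
  if a = Sum.inl 0 then
    if 0 ≤ i then sol.transition (s + i • unbarredShift a₀ a) s else 0
  else
    if 0 < i then sol.transition (s + i • unbarredShift a₀ a) s else 0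

/-- The element of `𝔤` that acts on `W` as the projection of `𝒯̄_a^i`. -/
def barredKernel (sol : Solution 𝔤) (b₀ a : Idx N) (s : Charge N) (i : ℤ) : 𝔤 :=
  if a = Sum.inl 0 then
    if 0 ≤ i then sol.transition (s + i • barredShift b₀ a) s else 0
  else if a = Sum.inr 0 ∧ b₀ = Sum.inl 0 then
    if 0 < i then sol.transition (s + i • barredShift b₀ a) s else 0
  else
    if 0 < i then sol.transition (s + i • barredShift b₀ a) s - 1 else 0

lemma unbarredShift_apply_self {a₀ : Idx N} (ha₀ : a₀ ≠ Sum.inl 0) (a : Idx N) :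
    (unbarredShift a₀ a).1 a = 1 := by
  rw [unbarredShift]
  split_ifs with h
  · subst h; exact transfer_apply_self ha₀.symm
  · exact transfer_apply_self h

lemma barredShift_apply_self {b₀ : Idx N} (hb₀ : b₀ ≠ Sum.inr 0) (a : Idx N) :
    (barredShift b₀ a).1 a = 1 := by
  rw [barredShift]
  split_ifs with h
  · subst h; exact transfer_apply_self hb₀.symm
  · exact transfer_apply_self h

variable (sol : Solution 𝔤)

lemma unbarredKernel_of_neg (a₀ a : Idx N) (s : Charge N) {i : ℤ} (hi : i < 0) :
    sol.unbarredKernel a₀ a s i = 0 := by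
  simp [unbarredKernel, not_le.2 hi, not_lt.2 hi.le]

lemma barredKernel_of_neg (b₀ a : Idx N) (s : Charge N) {i : ℤ} (hi : i < 0) :
    sol.barredKernel b₀ a s i = 0 := by
  simp [barredKernel, not_le.2 hi, not_lt.2 hi.le]

/-- Truncation in `i` turns into truncation in the power of `Λ`. For `i` kept, no barred charge is
raised, so negative powers are absent, and among the unbarred columns only `k` survives. For `i`
discarded, the kernel of `k` has no nonnegative powers in its first row; for `k ≠ 1` this already
holds at `i = 0`, whence `0 < i` in place of `0 ≤ i`. -/
lemma unbarredKernel_inl {a₀ : Idx N} (ha₀ : a₀ ≠ Sum.inl 0) (k : Fin N) (s : Charge N)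
    (i J n : ℤ) (c : Fin N) : (sol.unbarredKernel a₀ (Sum.inl k) s i).1 J n 0 c =
      if 0 ≤ J then (sol.kernel (Sum.inl k) (s + i • unbarredShift a₀ (Sum.inl k)) s).1 J n 0 c
      else 0 := by
  rw [unbarredKernel, unbarredShift]
  by_cases hk : k = 0
  · subst hk
    rw [if_pos rfl, if_pos rfl]
    split_ifs with hi hJ hJ
    · refine sol.transition_inl hJ (fun l hl => Or.inr ⟨?_, hl⟩) n c
      rw [add_zsmul_transfer_apply]
      split_ifs <;> simp_all
    · refine sol.transition_of_neg (by omega) (fun l => ?_) n c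
      rw [add_zsmul_transfer_apply]
      split_ifs <;> simp_all
    · refine (sol.kernel_inl_eq_zero (Or.inl ?_) hJ n c).symm
      rw [add_zsmul_transfer_apply, if_pos rfl, if_neg ha₀.symm]
      omega
    · rfl
  · have hk' : (Sum.inl k : Idx N) ≠ Sum.inl 0 := fun h => hk (Sum.inl_injective h)
    rw [if_neg hk', if_neg hk']
    split_ifs with hi hJ hJ
    · refine sol.transition_inl hJ (fun l hl => ?_) n c
      rw [add_zsmul_transfer_apply]
      by_cases h0 : l = 0 <;> simp_all
    · refine sol.transition_of_neg (by omega) (fun l => ?_) n c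
      rw [add_zsmul_transfer_apply]
      simp
    · refine (sol.kernel_inl_eq_zero (Or.inr ⟨?_, hk⟩) hJ n c).symm
      rw [add_zsmul_transfer_apply, if_pos rfl, if_neg hk']
      omega
    · rfl

/-- For `k ≠ 1` the shift takes charge from `1̄` and leaves `s_1` alone, so the identity has to be
subtracted; it does not touch the negative powers. -/
lemma barredKernel_inl {b₀ : Idx N} (k : Fin N) (s : Charge N)
    (i J n : ℤ) (c : Fin N) : (sol.barredKernel b₀ (Sum.inl k) s i).1 J n 0 c =
      if 0 ≤ J then (sol.kernel (Sum.inl k) (s + i • barredShift b₀ (Sum.inl k)) s).1 J n 0 c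
      else 0 := by
  rw [barredKernel, barredShift, if_neg Sum.inl_ne_inr]
  by_cases hk : k = 0
  · subst hk
    rw [if_pos rfl]
    split_ifs with hi hJ hJ
    · refine sol.transition_inl hJ (fun l hl => Or.inr ⟨?_, hl⟩) n c
      rw [add_zsmul_transfer_apply]
      split_ifs <;> simp_all
    · refine sol.transition_of_neg (by omega) (fun l => ?_) n c
      rw [add_zsmul_transfer_apply]
      split_ifs <;> simp_all
    · refine (sol.kernel_inl_eq_zero (Or.inl ?_) hJ n c).symm
      rw [add_zsmul_transfer_apply, if_pos rfl, if_neg Sum.inl_ne_inr]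
      omega
    · rfl
  · have hk' : (Sum.inl k : Idx N) ≠ Sum.inl 0 := fun h => hk (Sum.inl_injective h)
    rw [if_neg hk', if_neg (fun h => Sum.inl_ne_inr h.1)]
    split_ifs with hi hJ hJ
    · refine sol.transition_inl_sub_one hJ hk (fun l hl => ?_) ?_ n c
      · rw [add_zsmul_transfer_apply]
        simp_all
      · rw [add_zsmul_transfer_apply, if_neg hk'.symm, if_neg Sum.inl_ne_inr, sub_self, add_zero]
    · rw [sub_one_of_neg _ (by omega)]
      refine sol.transition_of_neg (by omega) (fun l => ?_) n c
      rw [add_zsmul_transfer_apply]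
      split_ifs <;> simp_all; omega
    · refine (sol.kernel_inl_eq_zero (Or.inr ⟨?_, hk⟩) hJ n c).symm
      rw [add_zsmul_transfer_apply, if_pos rfl, if_neg Sum.inl_ne_inr]
      omega
    · rfl

/-- For `i > 0` the shift lowers `s_1` and raises no unbarred charge, so the first row of the
transition has only negative powers. -/
lemma unbarredKernel_inr {a₀ : Idx N} (k : Fin N) (s : Charge N)
    (i J n : ℤ) (c : Fin N) : (sol.unbarredKernel a₀ (Sum.inr k) s i).1 J n 0 c =
      if J < 0 then (sol.kernel (Sum.inr k) (s + i • unbarredShift a₀ (Sum.inr k)) s).1 J n 0 c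
      else 0 := by
  rw [unbarredKernel, unbarredShift, if_neg Sum.inr_ne_inl, if_neg Sum.inr_ne_inl]
  split_ifs with hi hJ hJ
  · refine sol.transition_inr hJ (fun l hl => ?_) n c
    rw [add_zsmul_transfer_apply]
    simp_all
  · refine sol.transition_of_nonneg (by omega) (fun l hl => ?_) ?_ n c
    · rw [add_zsmul_transfer_apply]
      simp_all
    · rw [add_zsmul_transfer_apply]
      simp_all
  · refine (sol.kernel_inr_eq_zero ?_ hJ n 0 c).symm
    rw [add_zsmul_transfer_apply, if_pos rfl, if_neg Sum.inr_ne_inl]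
    omega
  · rfl

lemma barredKernel_inr {b₀ : Idx N} (hb₀ : b₀ ≠ Sum.inr 0) (k : Fin N) (s : Charge N)
    (i J n : ℤ) (c : Fin N) : (sol.barredKernel b₀ (Sum.inr k) s i).1 J n 0 c =
      if J < 0 then (sol.kernel (Sum.inr k) (s + i • barredShift b₀ (Sum.inr k)) s).1 J n 0 c
      else 0 := by
  rw [barredKernel, barredShift, if_neg Sum.inr_ne_inl]
  have hself : ∀ b : Idx N, b ≠ Sum.inr k → i ≤ 0 →
      (s + i • transfer (Sum.inr k) b).1 (Sum.inr k) ≤ s.1 (Sum.inr k) := by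
    intro b hb hi
    rw [add_zsmul_transfer_apply, if_pos rfl, if_neg hb.symm]
    omega
  have hothers : ∀ b : Idx N, 0 < i → ∀ c ≠ Sum.inr k,
      (s + i • transfer (Sum.inr k) b).1 c ≤ s.1 c := by
    intro b hi c hc
    rw [add_zsmul_transfer_apply, if_neg hc]
    split_ifs <;> omega
  have hinr : ∀ l ≠ k, (Sum.inr l : Idx N) ≠ Sum.inr k := fun l hl h => hl (Sum.inr_injective h)
  by_cases hk : k = 0 ∧ b₀ = Sum.inl 0
  · obtain ⟨rfl, rfl⟩ := hk
    rw [if_pos ⟨rfl, rfl⟩, if_pos rfl]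
    split_ifs with hi hJ hJ
    · exact sol.transition_inr hJ (fun l hl => hothers _ hi _ (hinr l hl)) n c
    · refine sol.transition_of_nonneg (by omega) (fun l hl => hothers _ hi _ Sum.inl_ne_inr) ?_ n c
      rw [add_zsmul_transfer_apply, if_neg Sum.inl_ne_inr, if_pos rfl]
      omega
    · exact (sol.kernel_inr_eq_zero (hself _ hb₀ (by omega)) hJ n 0 c).symm
    · rfl
  · rw [if_neg (fun h => hk ⟨Sum.inr_injective h.1, h.2⟩)]
    -- The lowered index `b` is `b₀` if `k̄ = 1̄` and `1̄` otherwise. It differs from `1`, so `s_1`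
    -- is unchanged and the nonnegative part of the first row is that of the identity.
    obtain ⟨b, hb, hbk, hb0⟩ : ∃ b : Idx N, (if (Sum.inr k : Idx N) = Sum.inr 0 then
        transfer (Sum.inr 0) b₀ else transfer (Sum.inr k) (Sum.inr 0)) = transfer (Sum.inr k) b ∧
        b ≠ Sum.inr k ∧ b ≠ Sum.inl 0 := by
      split_ifs with h
      · rw [h]
        exact ⟨b₀, rfl, hb₀, fun h' => hk ⟨Sum.inr_injective h, h'⟩⟩
      · exact ⟨Sum.inr 0, rfl, Ne.symm h, Sum.inr_ne_inl⟩
    rw [hb]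
    split_ifs with hi hJ hJ
    · rw [sub_one_of_neg _ hJ]
      exact sol.transition_inr hJ (fun l hl => hothers _ hi _ (hinr l hl)) n c
    · refine sol.transition_sub_one_of_nonneg (by omega)
        (fun l hl => hothers _ hi _ Sum.inl_ne_inr) ?_ n c
      rw [add_zsmul_transfer_apply, if_neg Sum.inl_ne_inr, if_neg hb0.symm, sub_self, add_zero]
    · exact (sol.kernel_inr_eq_zero (hself _ hbk (by omega)) hJ n 0 c).symm
    · rfl

end Solution

/-! ### Products with projected series -/

lemma firstRow_apply [NeZero N] (X : ShiftSeries N) (j n : ℤ) (r c : Fin N) :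
    firstRow X j n r c = if r = 0 then X j n 0 c else 0 := by
  rw [firstRow]
  split_ifs with h
  · rw [h, Matrix.single_mul_apply_same, one_mul]
  · rw [Matrix.single_mul_apply_of_ne _ _ _ _ _ h]

lemma IsProduct.unique {X Y Z Z' : ShiftSeries N} (h : IsProduct X Y Z) (h' : IsProduct X Y Z') :
    Z = Z' := by
  funext j n
  exact (h j n).unique (h' j n)

lemma ShiftOp.summable_coeff_mul {τ : Charge N} (P : ShiftOp τ) (n : ℤ) (s : Charge N)
    {y : ℤ → Coef N} (hy : ∀ i < 0, y i = 0) : Summable fun i => P.coeff i n s * y i := by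
  refine ShiftOp.summable_of_finite fun d => ?_
  obtain ⟨B, hB⟩ := P.bounded' d
  refine (Set.finite_Icc 0 B).subset fun i hi => ⟨?_, ?_⟩
  · by_contra hcon
    refine hi ?_
    rw [hy i (not_le.1 hcon), mul_zero, map_zero]
  · by_contra hcon
    exact hi (ShiftOp.coeff_mul_eq_zero (Or.inl fun e he => hB e he _ (by omega) _ _))

/-- The bound is independent of `y`, so one finite range of `i` serves all powers of `Λ` at once. -/
lemma ShiftOp.coeff_tsum_mul {τ : Charge N} (P : ShiftOp τ) (n : ℤ) (s : Charge N)
    (d : ℕ+ × Idx N →₀ ℕ) : ∃ B : ℤ, ∀ y : ℤ → Coef N, (∀ i < 0, y i = 0) →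
      MvPowerSeries.coeff d (∑' i, P.coeff i n s * y i) =
        ∑ i ∈ Finset.Icc 0 B, MvPowerSeries.coeff d (P.coeff i n s * y i) := by
  obtain ⟨B, hB⟩ := P.bounded' d
  refine ⟨B, fun y hy => ?_⟩
  refine (MvPowerSeries.WithPiTopology.hasSum_iff_hasSum_coeff.1
    (P.summable_coeff_mul n s hy).hasSum d).unique (hasSum_sum_of_ne_finset_zero fun i hi => ?_)
  by_cases h0 : 0 ≤ i
  · refine ShiftOp.coeff_mul_eq_zero (Or.inl fun e he => hB e he _ ?_ _ _)
    simp only [Finset.mem_Icc, not_and, not_le] at hi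
    exact hi h0
  · rw [hy i (not_le.1 h0), mul_zero, map_zero]

/-- A series `∑_i c_i E_{11} D_i` with `c_i` bounded above in every order and `D_i = 0` for `i < 0`
converges. -/
lemma hasSum_coeff_smul [NeZero N] {τ : Charge N} (P : ShiftOp τ) (s : Charge N)
    {D : ℤ → ShiftSeries N} (hD : ∀ i < 0, D i = 0) (j n : ℤ) :
    HasSum (fun i => P.coeff i n s • firstRow (D i) j n)
      (Matrix.of fun r c => ∑' i, P.coeff i n s * firstRow (D i) j n r c) := by
  refine Pi.hasSum.2 fun r => Pi.hasSum.2 fun c => ?_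
  refine (P.summable_coeff_mul n s fun i hi => ?_).hasSum
  rw [hD i hi, firstRow_apply]
  split_ifs <;> rfl

/-- The projected series is not assumed to lie in `𝔤`, so the convergence of its product with `Z`
needs proof. In each order it is a finite combination of the convergent products `D_i Z`. -/
lemma isProduct_firstRow_part [NeZero N] {𝔤 : LaurentAlgebra N} {τ : Charge N} (P : ShiftOp τ)
    (s : Charge N) {A D : ℤ → 𝔤} (hD0 : ∀ i < 0, D i = 0) (π : ℤ → Prop) [DecidablePred π]
    (hD : ∀ i J n c, (D i).1 J n 0 c = if π J then (A i).1 J n 0 c else 0) {Q : ShiftSeries N}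
    (hQ : ∀ J n c, Q J n 0 c = ∑' i, P.coeff i n s * (A i).1 J n 0 c) (Z : 𝔤) :
    IsProduct (firstRow fun J n => if π J then Q J n else 0) Z.1
      fun j n => Matrix.of fun r c => ∑' i, P.coeff i n s * firstRow (D i * Z).1 j n r c := by
  intro j n
  refine Pi.hasSum.2 fun r => Pi.hasSum.2 fun c => ?_
  simp only [Matrix.of_apply, Matrix.mul_apply, firstRow_apply]
  by_cases hr : r = 0
  swap
  · simp only [if_neg hr, zero_mul, mul_zero, Finset.sum_const_zero, tsum_zero]
    exact hasSum_zero
  simp only [if_pos hr]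
  have hQD : ∀ J l, (if π J then Q J n else 0) 0 l = ∑' i, P.coeff i n s * (D i).1 J n 0 l := by
    intro J l
    simp only [hD]
    split_ifs
    · exact hQ J n l
    · simp
  simp only [hQD]
  have h0 : ∀ i < 0, ∀ J m l, (D i).1 J m 0 l = 0 := by
    intro i hi J m l
    rw [hD0 i hi]
    rfl
  have hswap : ∀ p, ∑ l, (∑' i, P.coeff i n s * (D i).1 p n 0 l) * Z.1 (j - p) (n + p) l c =
      ∑' i, P.coeff i n s * ∑ l, (D i).1 p n 0 l * Z.1 (j - p) (n + p) l c := by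
    intro p
    have hs : ∀ l, Summable fun i => P.coeff i n s * (D i).1 p n 0 l := fun l =>
      P.summable_coeff_mul n s fun i hi => h0 i hi p n l
    simp only [Finset.mul_sum, ← mul_assoc]
    rw [Summable.tsum_finsetSum fun l _ => (hs l).mul_right _]
    exact Finset.sum_congr rfl fun l _ => ((hs l).tsum_mul_right _).symm
  rw [funext hswap, MvPowerSeries.WithPiTopology.hasSum_iff_hasSum_coeff]
  intro d
  obtain ⟨B, hB⟩ := P.coeff_tsum_mul n s d
  rw [hB _ fun i hi => by rw [hD0 i hi, zero_mul]; rfl]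
  rw [funext fun p => hB _ fun i hi => Finset.sum_eq_zero fun l _ => by rw [h0 i hi, zero_mul]]
  exact hasSum_sum fun i _ => MvPowerSeries.WithPiTopology.hasSum_iff_hasSum_coeff.1
    ((hasSum_mul_apply (D i) Z j n 0 c).mul_left _) d

/-! ### From kernels to the action of the projected operators. -/

namespace Solution

variable [NeZero N] {𝔤 : LaurentAlgebra N} {sol : Solution 𝔤} {τ τ' : Charge N} {a : Idx N}

/-- If the first rows of `D_i` and `D'_i` are the projections of the first row of
`V(s + iτ) E_{kk} V(s)⁻¹` along `τ` and `τ'`, then both act on `Z` as the projection of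
`F(M, L) C_{kk}`. -/
lemma exists_isProduct_hasSum (hK : IsUnit (sol.K τ a)) (hK' : IsUnit (sol.K τ' a))
    (hτ : τ.1 a = 1) (hτ' : τ'.1 a = 1) (F : Symbol) (π : ℤ → Prop) [DecidablePred π]
    {D D' : Charge N → ℤ → 𝔤} (hD0 : ∀ s, ∀ i < 0, D s i = 0) (hD0' : ∀ s, ∀ i < 0, D' s i = 0)
    (hD : ∀ s i J n c, (D s i).1 J n 0 c =
      if π J then (sol.kernel a (s + i • τ) s).1 J n 0 c else 0)
    (hD' : ∀ s i J n c, (D' s i).1 J n 0 c =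
      if π J then (sol.kernel a (s + i • τ') s).1 J n 0 c else 0)
    {Q : Charge N → ShiftSeries N}
    (hQ : ∀ s J n c, Q s J n 0 c = ∑' x : ℤ × ℤ, F.eval x.2 ((n + x.1 : ℤ) : ℂ) •
      ((sol.dressing a s).val.1 x.1 n 0 (column a) *
        ((sol.dressing a s)⁻¹).val.1 (J - x.1 - sg a * x.2) (n + x.1 + sg a * x.2) (column a) c))
    (Z : Charge N → 𝔤) :
    ∃ Y : Charge N → ShiftSeries N,
      (∀ s, IsProduct (firstRow fun J n => if π J then Q s J n else 0) (Z s).1 (Y s)) ∧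
      (∀ s j n, HasSum (fun i => scalarSeries hK F i n s • firstRow (D s i * Z s).1 j n)
        (Y s j n)) ∧
      (∀ s j n, HasSum (fun i => scalarSeries hK' F i n s • firstRow (D' s i * Z s).1 j n)
        (Y s j n)) := by
  rw [scalarSeries_eq, scalarSeries_eq]
  have h1 := fun s => isProduct_firstRow_part (dressedSymbol hK F) s (hD0 s) π (hD s)
    (fun J n c => (hQ s J n c).trans (tsum_dressedSymbol_mul_kernel hK hτ F s J n c)) (Z s)
  have h2 := fun s => isProduct_firstRow_part (dressedSymbol hK' F) s (hD0' s) π (hD' s)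
    (fun J n c => (hQ s J n c).trans (tsum_dressedSymbol_mul_kernel hK' hτ' F s J n c)) (Z s)
  refine ⟨_, h1, fun s j n => ?_, fun s j n => ?_⟩
  · exact hasSum_coeff_smul (dressedSymbol hK F) s (D := fun i => (D s i * Z s).1)
      (fun i hi => by rw [hD0 s i hi, zero_mul]; rfl) j n
  -- The sums along `τ` and along `τ'` agree because both equal the product of the same projected
  -- series with `Z`.
  · refine Eq.mpr (congrArg (fun x => HasSum _ x)
      (congrFun (congrFun ((h1 s).unique (h2 s)) j) n)) ?_
    exact hasSum_coeff_smul (dressedSymbol hK' F) s (D := fun i => (D' s i * Z s).1)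
      (fun i hi => by rw [hD0' s i hi, zero_mul]; rfl) j n

lemma unbarredPlusActs_of_hasSum (sol : Solution 𝔤) (a₀ a b : Idx N)
    {c : ℤ → ℤ → Charge N → Coef N} {Y : Charge N → ShiftSeries N}
    (h : ∀ s j n, HasSum (fun i => c i n s •
      firstRow (sol.unbarredKernel a₀ a s i * (sol.dressing b s).val).1 j n) (Y s j n)) :
    UnbarredPlusActs a₀ a c (fun s => firstRow (sol.dressing b s).val.1) Y := by
  have h0 : ∀ j n, firstRow (0 : 𝔤).1 j n = 0 := fun j n => mul_zero _
  intro s j n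
  refine Eq.mp (congrArg (fun f => HasSum f _) (funext fun i => ?_)) (h s j n)
  rw [unbarredKernel]
  split_ifs
  · rw [transition_mul_dressing]
  · rw [zero_mul, h0, smul_zero]
  · rw [transition_mul_dressing]
  · rw [zero_mul, h0, smul_zero]

lemma barredPlusActs_of_hasSum (sol : Solution 𝔤) (b₀ a b : Idx N)
    {c : ℤ → ℤ → Charge N → Coef N} {Y : Charge N → ShiftSeries N}
    (h : ∀ s j n, HasSum (fun i => c i n s •
      firstRow (sol.barredKernel b₀ a s i * (sol.dressing b s).val).1 j n) (Y s j n)) :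
    BarredPlusActs b₀ a c (fun s => firstRow (sol.dressing b s).val.1) Y := by
  have h0 : ∀ j n, firstRow (0 : 𝔤).1 j n = 0 := fun j n => mul_zero _
  have hsub : ∀ (X X' : 𝔤) j n, firstRow (X - X').1 j n = firstRow X.1 j n - firstRow X'.1 j n :=
    fun X X' j n => mul_sub _ _ _
  intro s j n
  refine Eq.mp (congrArg (fun f => HasSum f _) (funext fun i => ?_)) (h s j n)
  rw [barredKernel]
  split_ifs
  · rw [transition_mul_dressing]
  · rw [zero_mul, h0, smul_zero]
  · rw [transition_mul_dressing]
  · rw [zero_mul, h0, smul_zero]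
  · rw [sub_mul, transition_mul_dressing, one_mul, hsub]
  · rw [zero_mul, h0, smul_zero]

end Solution

end Toda

end

theorem mainTheorem2 {N : ℕ} [NeZero N] (𝔤 : Toda.LaurentAlgebra N) (sol : Toda.Solution 𝔤)
    (F : Toda.Symbol) (a₀ b₀ : Toda.Idx N) (ha₀ : a₀ ≠ Sum.inl 0) (hb₀ : b₀ ≠ Sum.inr 0) :
    (∀ (k : Fin N)
        (hK : IsUnit (sol.K (Toda.unbarredShift a₀ (Sum.inl k)) (Sum.inl k)))
        (hKbar : IsUnit (sol.K (Toda.barredShift b₀ (Sum.inl k)) (Sum.inl k))),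
      (∀ s, Summable (Toda.symbolTerm F (sol.M s) (sol.L s) (sol.C s k))) ∧
      Summable (Toda.Solution.scalarTerm hK F) ∧
      Summable (Toda.Solution.scalarTerm hKbar F) ∧
      ∃ Y Ybar : Toda.Charge N → Toda.ShiftSeries N,
        (∀ s, Toda.IsProduct
          (Toda.firstRow (Toda.posPart (Toda.symbolSeries F (sol.M s) (sol.L s) (sol.C s k))))
          (sol.W s : 𝔤).1 (Y s)) ∧
        Toda.UnbarredPlusActs a₀ (Sum.inl k) (Toda.Solution.scalarSeries hK F)
          (fun s => Toda.firstRow (sol.W s : 𝔤).1) Y ∧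
        Toda.BarredPlusActs b₀ (Sum.inl k) (Toda.Solution.scalarSeries hKbar F)
          (fun s => Toda.firstRow (sol.W s : 𝔤).1) Y ∧
        (∀ s, Toda.IsProduct
          (Toda.firstRow (Toda.posPart (Toda.symbolSeries F (sol.M s) (sol.L s) (sol.C s k))))
          (sol.Wbar s : 𝔤).1 (Ybar s)) ∧
        Toda.UnbarredPlusActs a₀ (Sum.inl k) (Toda.Solution.scalarSeries hK F)
          (fun s => Toda.firstRow (sol.Wbar s : 𝔤).1) Ybar ∧
        Toda.BarredPlusActs b₀ (Sum.inl k) (Toda.Solution.scalarSeries hKbar F)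
          (fun s => Toda.firstRow (sol.Wbar s : 𝔤).1) Ybar) ∧
    (∀ (k : Fin N)
        (hK : IsUnit (sol.K (Toda.unbarredShift a₀ (Sum.inr k)) (Sum.inr k)))
        (hKbar : IsUnit (sol.K (Toda.barredShift b₀ (Sum.inr k)) (Sum.inr k))),
      (∀ s, Summable (Toda.symbolTerm F (sol.Mbar s) (sol.Lbar s)⁻¹ (sol.Cbar s k))) ∧
      Summable (Toda.Solution.scalarTerm hK F) ∧
      Summable (Toda.Solution.scalarTerm hKbar F) ∧
      ∃ Y Ybar : Toda.Charge N → Toda.ShiftSeries N,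
        (∀ s, Toda.IsProduct
          (Toda.firstRow (Toda.negPart
            (Toda.symbolSeries F (sol.Mbar s) (sol.Lbar s)⁻¹ (sol.Cbar s k))))
          (sol.W s : 𝔤).1 (Y s)) ∧
        Toda.UnbarredPlusActs a₀ (Sum.inr k) (Toda.Solution.scalarSeries hK F)
          (fun s => Toda.firstRow (sol.W s : 𝔤).1) Y ∧
        Toda.BarredPlusActs b₀ (Sum.inr k) (Toda.Solution.scalarSeries hKbar F)
          (fun s => Toda.firstRow (sol.W s : 𝔤).1) Y ∧
        (∀ s, Toda.IsProduct
          (Toda.firstRow (Toda.negPart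
            (Toda.symbolSeries F (sol.Mbar s) (sol.Lbar s)⁻¹ (sol.Cbar s k))))
          (sol.Wbar s : 𝔤).1 (Ybar s)) ∧
        Toda.UnbarredPlusActs a₀ (Sum.inr k) (Toda.Solution.scalarSeries hK F)
          (fun s => Toda.firstRow (sol.Wbar s : 𝔤).1) Ybar ∧
        Toda.BarredPlusActs b₀ (Sum.inr k) (Toda.Solution.scalarSeries hKbar F)
          (fun s => Toda.firstRow (sol.Wbar s : 𝔤).1) Ybar) := by

  constructor
  · intro k hK hKbar
    have hQ := fun s => sol.hasSum_symbolTerm_inl F k s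
    have key := fun b => Toda.Solution.exists_isProduct_hasSum hK hKbar
      (Toda.Solution.unbarredShift_apply_self ha₀ _) (Toda.Solution.barredShift_apply_self hb₀ _) F
      (fun J => 0 ≤ J) (D := sol.unbarredKernel a₀ (Sum.inl k))
      (D' := sol.barredKernel b₀ (Sum.inl k))
      (fun s i hi => sol.unbarredKernel_of_neg _ _ _ hi)
      (fun s i hi => sol.barredKernel_of_neg _ _ _ hi)
      (sol.unbarredKernel_inl ha₀ k) (sol.barredKernel_inl k)
      (Q := fun s => Toda.symbolSeries F (sol.M s) (sol.L s) (sol.C s k))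
      (fun s J n c => congrFun (congrFun (congrFun (congrFun (hQ s).tsum_eq J) n) 0) c)
      (fun s => (sol.dressing b s).val)
    -- Only the side of the index matters: any unbarred `b` gives `W`, any barred `b` gives `W̄`.
    obtain ⟨Y, h1, h2, h3⟩ := key (Sum.inl 0)
    obtain ⟨Ybar, h1', h2', h3'⟩ := key (Sum.inr 0)
    exact ⟨fun s => (hQ s).summable, (Toda.Solution.hasSum_scalarTerm hK F).summable,
      (Toda.Solution.hasSum_scalarTerm hKbar F).summable, Y, Ybar, h1,
      sol.unbarredPlusActs_of_hasSum a₀ _ (Sum.inl 0) h2,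
      sol.barredPlusActs_of_hasSum b₀ _ (Sum.inl 0) h3, h1',
      sol.unbarredPlusActs_of_hasSum a₀ _ (Sum.inr 0) h2',
      sol.barredPlusActs_of_hasSum b₀ _ (Sum.inr 0) h3'⟩
  · intro k hK hKbar
    have hQ := fun s => sol.hasSum_symbolTerm_inr F k s
    have key := fun b => Toda.Solution.exists_isProduct_hasSum hK hKbar
      (Toda.Solution.unbarredShift_apply_self ha₀ _) (Toda.Solution.barredShift_apply_self hb₀ _) F
      (fun J => J < 0) (D := sol.unbarredKernel a₀ (Sum.inr k))
      (D' := sol.barredKernel b₀ (Sum.inr k))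
      (fun s i hi => sol.unbarredKernel_of_neg _ _ _ hi)
      (fun s i hi => sol.barredKernel_of_neg _ _ _ hi)
      (sol.unbarredKernel_inr k) (sol.barredKernel_inr hb₀ k)
      (Q := fun s => Toda.symbolSeries F (sol.Mbar s) (sol.Lbar s)⁻¹ (sol.Cbar s k))
      (fun s J n c => congrFun (congrFun (congrFun (congrFun (hQ s).tsum_eq J) n) 0) c)
      (fun s => (sol.dressing b s).val)
    obtain ⟨Y, h1, h2, h3⟩ := key (Sum.inl 0)
    obtain ⟨Ybar, h1', h2', h3'⟩ := key (Sum.inr 0)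
    exact ⟨fun s => (hQ s).summable, (Toda.Solution.hasSum_scalarTerm hK F).summable,
      (Toda.Solution.hasSum_scalarTerm hKbar F).summable, Y, Ybar, h1,
      sol.unbarredPlusActs_of_hasSum a₀ _ (Sum.inl 0) h2,
      sol.barredPlusActs_of_hasSum b₀ _ (Sum.inl 0) h3, h1',
      sol.unbarredPlusActs_of_hasSum a₀ _ (Sum.inr 0) h2',
      sol.barredPlusActs_of_hasSum b₀ _ (Sum.inr 0) h3'⟩
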